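/- Fix $d\ge 1$ and $p\in(0,1)$. A stationary random equivalence relation (RER) on $\mathbb Z^d$ is a probability measure $\nu$ on the set of partitions of $\mathbb Z^d$, equipped with the $\sigma$-algebra generated by the restrictions $\pi\mapsto\pi_K$ to finite sets $K\subset\mathbb Z^d$, that is invariant under all translations of $\mathbb Z^d$; the classes of a partition are called its clusters. Given a random partition $\pi$ with law $\nu$, give each cluster, independently of the other clusters, the value $1$ with probability $p$ and the value $0$ with probability $1-p$, and let $X^{\nu,p}\in\{0,1\}^{\mathbb Z^d}$ assign to each vertex the value of its cluster. Let $\mathbf P_{\nu,p}$ be the joint law of $(\pi,X^{\nu,p})$ and $\Phi_p(\nu)$ the law of $X^{\nu,p}$. A set $S\subseteq\mathbb Z^d$ has density $\alpha$ if $\lim_{n\to\infty}|S\cap B_n|/|B_n|=\alpha$, where $B_n=[-n,n]^d\cap\mathbb Z^d$; it has positive density if it has a density $\alpha>0$. Ergodicity refers to the action of $\mathbb Z^d$ by translations (acting diagonally on pairs $(\pi,X^{\nu,p})$). Assume that $\nu$ is a stationary RER on $\mathbb Z^d$ with $$\nu(\exists\,\phi\in\pi:\ \phi\text{ has positive density})=0.$$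 Then $\nu$ is ergodic if and only if $\mathbf P_{\nu,p}$ is ergodic. In particular, if $\nu$ is ergodic, then $\Phi_p(\nu)$ is ergodic. -/

import Mathlib

open MeasureTheory ProbabilityTheory Filter
open scoped Topology

/-! A partition of `V` is represented by the equivalence relation `π : Setoid V` whose classes
(`π.classes : Set (Set V)`) are its clusters. A random equivalence relation (RER) on `V` is a
probability measure on `Setoid V`. -/

namespace ColorProcess

section Partitions

variable {V : Type*}

/-- The partition of a finite set `K ⊆ V` induced by a partition of `V`. -/
def induced (K : Finset V) (π : Setoid V) : Setoid K := π.comap Subtype.val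

/-- The σ-algebra on the set of partitions of `V` generated by the maps `π ↦ π_K`, `K` finite,
where the set of partitions of the finite set `K` carries the discrete σ-algebra. -/
instance instMeasurableSpaceSetoid : MeasurableSpace (Setoid V) :=
  ⨆ K : Finset V, MeasurableSpace.comap (induced K) ⊤

theorem measurableSet_rel (u v : V) : MeasurableSet {π : Setoid V | π u v} := by
  classical
  have hle : MeasurableSpace.comap (induced ({u, v} : Finset V)) ⊤
      ≤ (instMeasurableSpaceSetoid : MeasurableSpace (Setoid V)) :=
    le_iSup (fun K : Finset V => MeasurableSpace.comap (induced K) ⊤) {u, v}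
  refine hle _ ⟨{ρ | ρ ⟨u, by simp⟩ ⟨v, by simp⟩}, trivial, ?_⟩
  ext π
  rfl

end Partitions

section Colors

variable {V : Type*}

/-- The law of a coloring of `V` given the partition `π`: the clusters of `π` (the points of
`Quotient π`) receive i.i.d. values, equal to `1` with probability `p` and to `0` with
probability `1 - p`, and every vertex takes the value of its cluster. -/
noncomputable def colorLawGiven (p : unitInterval) (π : Setoid V) : Measure (V → Fin 2) :=
  (Measure.infinitePi (fun _ : Quotient π => bernoulliMeasure (1 : Fin 2) 0 p)).map
    (fun ω v => ω (Quotient.mk π v))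

theorem isProbabilityMeasure_colorLawGiven (p : unitInterval) (π : Setoid V) :
    IsProbabilityMeasure (colorLawGiven p π) :=
  Measure.isProbabilityMeasure_map
    (measurable_pi_lambda _ fun v => measurable_pi_apply (Quotient.mk π v)).aemeasurable

/-- In each class of a partition of a countable set there is a vertex with the least code. -/
theorem exists_least [Encodable V] (π : Setoid V) (v : V) :
    ∃ u, π u v ∧ ∀ w, π w v → Encodable.encode u ≤ Encodable.encode w := by
  obtain ⟨u, hu, hmin⟩ := (measure (Encodable.encode : V → ℕ)).wf.has_min {u | π u v}
    ⟨v, π.refl v⟩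
  exact ⟨u, hu, fun w hw => not_lt.1 (hmin w hw)⟩

/-- The vertex with the least code in the cluster of `v`. -/
noncomputable def rep [Encodable V] (π : Setoid V) (v : V) : V := (exists_least π v).choose

theorem rep_eq_iff [Encodable V] (π : Setoid V) (u v : V) :
    rep π v = u ↔ π u v ∧ ∀ w, π w v → Encodable.encode u ≤ Encodable.encode w := by
  have h := (exists_least π v).choose_spec
  constructor
  · rintro rfl
    exact h
  · rintro ⟨h1, h2⟩
    exact Encodable.encode_injective (le_antisymm (h.2 u h1) (h2 _ h.1))

theorem rep_eq_rep_iff [Encodable V] (π : Setoid V) (u v : V) : rep π u = rep π v ↔ π u v := by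
  have hu := (rep_eq_iff π _ u).1 rfl
  have hv := (rep_eq_iff π _ v).1 rfl
  constructor
  · intro h
    exact π.trans (π.symm hu.1) (h ▸ hv.1)
  · intro h
    exact (rep_eq_iff π _ u).2 ⟨π.trans hv.1 (π.symm h), fun w hw => hv.2 w (π.trans hw h)⟩

/-- The conditional law of the coloring, realized by one i.i.d. field on the vertices. -/
theorem colorLawGiven_eq_map [Encodable V] (p : unitInterval) (π : Setoid V) :
    colorLawGiven p π = (Measure.infinitePi (fun _ : V => bernoulliMeasure (1 : Fin 2) 0 p)).map
      (fun Y v => Y (rep π v)) := by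
  let f : Quotient π → V := Quotient.lift (rep π) fun a b h => (rep_eq_rep_iff π a b).2 h
  have hf : Function.Injective f := by
    intro a b
    induction a using Quotient.inductionOn
    induction b using Quotient.inductionOn
    exact fun h => Quotient.sound ((rep_eq_rep_iff π _ _).1 h)
  rw [colorLawGiven, ← Measure.map_infinitePi_infinitePi_of_inj
    (P := fun _ : V => bernoulliMeasure (1 : Fin 2) 0 p) hf, Measure.map_map (by fun_prop)
    (by fun_prop)]
  rfl

theorem measurable_colorLawGiven [Countable V] (p : unitInterval) :
    Measurable (colorLawGiven (V := V) p) := by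
  have := Encodable.ofCountable V
  have hjoint : Measurable (fun (z : Setoid V × (V → Fin 2)) v => z.2 (rep z.1 v)) := by
    refine measurable_pi_lambda _ fun v => ?_
    let : MeasurableSpace V := ⊤
    have hrep : Measurable fun π : Setoid V => rep π v := by
      refine measurable_to_countable' fun u => ?_
      have : (fun π : Setoid V => rep π v) ⁻¹' {u} = {π : Setoid V | π u v} ∩
          ⋂ w : V, {π : Setoid V | π w v → Encodable.encode u ≤ Encodable.encode w} := by
        ext π
        simp [rep_eq_iff]
      rw [this]
      refine (measurableSet_rel u v).inter (MeasurableSet.iInter fun w => ?_)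
      exact (measurableSet_rel w v).imp (MeasurableSet.const _)
    have heval : Measurable fun q : V × (V → Fin 2) => q.2 q.1 :=
      measurable_from_prod_countable_right fun u => measurable_pi_apply u
    exact heval.comp ((hrep.comp measurable_fst).prodMk measurable_snd)
  refine Measure.measurable_of_measurable_coe _ fun s hs => ?_
  have h : ∀ π : Setoid V, colorLawGiven p π s =
      Measure.infinitePi (fun _ : V => bernoulliMeasure (1 : Fin 2) 0 p)
        (Prod.mk π ⁻¹' ((fun (z : Setoid V × (V → Fin 2)) v => z.2 (rep z.1 v)) ⁻¹' s)) := by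
    intro π
    have hm : Measurable fun (Y : V → Fin 2) v => Y (rep π v) :=
      measurable_pi_lambda _ fun v => measurable_pi_apply (rep π v)
    rw [colorLawGiven_eq_map, Measure.map_apply hm hs]
    rfl
  simp only [h]
  exact measurable_measure_prodMk_left (hjoint hs)

/-- `colorLawGiven p` as a Markov kernel from partitions to colorings. -/
noncomputable def colorKernel (V : Type*) [Countable V] (p : unitInterval) :
    Kernel (Setoid V) (V → Fin 2) where
  toFun := colorLawGiven p
  measurable' := measurable_colorLawGiven p

instance instIsMarkovKernelColorKernel [Countable V] (p : unitInterval) :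
    IsMarkovKernel (colorKernel V p) :=
  ⟨isProbabilityMeasure_colorLawGiven p⟩

/-- The joint law of the random partition `π` with law `ν` and of its color process. -/
noncomputable def jointLaw [Countable V] (ν : Measure (Setoid V)) (p : unitInterval) :
    Measure (Setoid V × (V → Fin 2)) :=
  ν ⊗ₘ colorKernel V p

/-- The law of the color process associated with `ν` and `p`. -/
noncomputable def colorLaw [Countable V] (ν : Measure (Setoid V)) (p : unitInterval) :
    Measure (V → Fin 2) :=
  (jointLaw ν p).snd

end Colors

section Translations

variable {G : Type*} [AddCommGroup G]

/-- Translation of partitions: the clusters of `x +ᵥ π` are the translates by `x` of the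
clusters of `π`. -/
instance instAddActionSetoid : AddAction G (Setoid G) where
  vadd x π := π.comap fun y => y - x
  zero_vadd π := by
    ext y z
    change π (y - 0) (z - 0) ↔ π y z
    simp
  add_vadd x x' π := by
    ext y z
    change π (y - (x + x')) (z - (x + x')) ↔ π (y - x - x') (z - x - x')
    simp [sub_sub]

/-- Translation of colorings. On pairs (partition, coloring) the group acts diagonally. -/
instance instAddActionColoring : AddAction G (G → Fin 2) where
  vadd x X := fun y => X (y - x)
  zero_vadd X := by
    funext y
    change X (y - 0) = X y
    simp
  add_vadd x x' X := by
    funext y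
    change X (y - (x + x')) = X (y - x - x')
    simp [sub_sub]

end Translations

section Density

variable {d : ℕ}

/-- The box `B_n = [-n, n]^d ∩ ℤ^d`. -/
noncomputable def box (d n : ℕ) : Finset (Fin d → ℤ) := Finset.Icc (fun _ => -(n : ℤ)) (fun _ => (n : ℤ))

/-- `S ⊆ ℤ^d` has density `α`: `|S ∩ B_n| / |B_n| → α`. -/
def HasDensity (S : Set (Fin d → ℤ)) (α : ℝ) : Prop :=
  Tendsto (fun n : ℕ => ((S ∩ (box d n : Set (Fin d → ℤ))).ncard : ℝ) / ((box d n).card : ℝ))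
    atTop (𝓝 α)

/-- `S` has a density, and it is positive. -/
def HasPositiveDensity (S : Set (Fin d → ℤ)) : Prop := ∃ α : ℝ, 0 < α ∧ HasDensity S α

end Density

end ColorProcess

open ColorProcess

/-! Both marginals of the joint law are images under equivariant projections, and factors of ergodic
actions are ergodic. The work is therefore to pass ergodicity from `ν` to the joint law `P`.

Let `A` be an event that depends on `π` and on the colors of a finite set `K`, and let `g π` be its
conditional probability given `π`. If no cluster meets both `K` and `K - x`, the colors on these two
sets are conditionally independent, so the conditional probability of `A ∩ x⁻¹A` is `g π * g (x +ᵥ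
π)`. Hence `P (A ∩ x⁻¹A)` differs from `∫ g π * g (x +ᵥ π)` by at most the probability that some
cluster meets both sets (`abs_jointLaw_real_inter_sub_le`). Averaged over `x ∈ B_n`, this error
vanishes because clusters have density zero (`tendsto_boxAvg_rel`), while the integrals tend to `(∫
g)² = (P A)²` by ergodicity of `ν` (`tendsto_boxAvg_correlation`). Approximating an invariant event
`E` by such `A` gives `P E = (P E)²`.

The hypothesis excludes only clusters whose frequencies converge to a positive limit, so the
existence of densities has to be proved (`ae_exists_hasDensity`). The pointwise ergodic theorem
makes the box averages of a random coloring converge. Correlating them with the color of one vertex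
`u` isolates the frequency of the cluster of `u`. The pointwise theorem itself follows from the mean
ergodic theorem and a maximal inequality based on Vitali covering. -/

namespace ColorProcess

open scoped ENNReal symmDiff

/-! ### Box averages and their asymptotic invariance under shifts -/

section Box

variable {d : ℕ}

theorem mem_box {n : ℕ} {x : Fin d → ℤ} : x ∈ box d n ↔ ∀ i, |x i| ≤ n := by
  simp only [box, Finset.mem_Icc, Pi.le_def, abs_le, forall_and]

theorem card_box (d n : ℕ) : (box d n).card = (2 * n + 1) ^ d := by
  rw [box, Pi.card_Icc]
  simp only [Int.card_Icc, Finset.prod_const, Finset.card_univ, Fintype.card_fin]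
  congr 1
  omega

theorem card_box_pos (d n : ℕ) : 0 < ((box d n).card : ℝ) := by
  rw [card_box]
  positivity

theorem neg_mem_box {n : ℕ} {x : Fin d → ℤ} : -x ∈ box d n ↔ x ∈ box d n := by
  simp [mem_box]

theorem exists_mem_box (x : Fin d → ℤ) : ∃ k, x ∈ box d k := by
  refine ⟨∑ i, (x i).natAbs, mem_box.2 fun i => ?_⟩
  rw [Int.abs_eq_natAbs]
  exact_mod_cast Finset.single_le_sum (f := fun i => (x i).natAbs) (fun _ _ => Nat.zero_le _)
    (Finset.mem_univ i)

theorem box_mono {m n : ℕ} (h : m ≤ n) : box d m ⊆ box d n := fun x hx =>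
  mem_box.2 fun i => (mem_box.1 hx i).trans (by exact_mod_cast h)

theorem add_mem_box {m n : ℕ} {x y : Fin d → ℤ} (hx : x ∈ box d m) (hy : y ∈ box d n) :
    x + y ∈ box d (n + m) := mem_box.2 fun i => by
  have h1 := mem_box.1 hx i
  have h2 := mem_box.1 hy i
  have h3 := abs_add_le (x i) (y i)
  push_cast
  simp only [Pi.add_apply]
  omega

/-- The bound on the effect of shifting a box average of a bounded function by a vector
of sup norm at most `k`. -/
noncomputable def boxDefect (d k n : ℕ) : ℝ := 2 * ((box d (n + k)).card / (box d n).card - 1)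

theorem tendsto_boxDefect (d k : ℕ) : Tendsto (boxDefect d k) atTop (𝓝 0) := by
  have h1 : Tendsto (fun n : ℕ => 1 + (2 * k : ℝ) / (2 * n + 1)) atTop (𝓝 (1 + 0)) := by
    refine tendsto_const_nhds.add (tendsto_const_nhds.div_atTop ?_)
    exact tendsto_atTop_add_const_right _ _
      (tendsto_natCast_atTop_atTop.const_mul_atTop (by norm_num))
  have h2 := (((h1.pow d).sub_const 1).const_mul 2)
  simp only [add_zero, one_pow, sub_self, mul_zero] at h2
  refine h2.congr fun n => ?_
  rw [boxDefect, card_box, card_box]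
  push_cast
  rw [← div_pow]
  congr 3
  field_simp
  ring

variable {E : Type*} [NormedAddCommGroup E] [NormedSpace ℝ E]

/-- The average of a function over the box `B_n`. -/
noncomputable def boxAvg (n : ℕ) (a : (Fin d → ℤ) → E) : E :=
  ((box d n).card : ℝ)⁻¹ • ∑ x ∈ box d n, a x

theorem boxAvg_const (n : ℕ) (e : E) : boxAvg n (fun _ : Fin d → ℤ => e) = e := by
  have := (card_box_pos d n).ne'
  rw [boxAvg, Finset.sum_const, ← Nat.cast_smul_eq_nsmul ℝ, smul_smul, inv_mul_cancel₀ this,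
    one_smul]

theorem boxAvg_add (n : ℕ) (a b : (Fin d → ℤ) → E) :
    boxAvg n (fun x => a x + b x) = boxAvg n a + boxAvg n b := by
  simp [boxAvg, Finset.sum_add_distrib]

theorem boxAvg_sub (n : ℕ) (a b : (Fin d → ℤ) → E) :
    boxAvg n (fun x => a x - b x) = boxAvg n a - boxAvg n b := by
  simp [boxAvg, Finset.sum_sub_distrib, smul_sub]

theorem boxAvg_smul (n : ℕ) (c : ℝ) (a : (Fin d → ℤ) → E) :
    boxAvg n (fun x => c • a x) = c • boxAvg n a := by
  simp only [boxAvg, ← Finset.smul_sum]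
  rw [smul_comm]

theorem norm_boxAvg_le (n : ℕ) (a : (Fin d → ℤ) → E) :
    ‖boxAvg n a‖ ≤ boxAvg n (fun x => ‖a x‖) := by
  rw [boxAvg, norm_smul, norm_inv, Real.norm_natCast, boxAvg, smul_eq_mul]
  gcongr
  exact norm_sum_le _ _

theorem boxAvg_mono (n : ℕ) {a b : (Fin d → ℤ) → ℝ} (h : ∀ x, a x ≤ b x) :
    boxAvg n a ≤ boxAvg n b := by
  rw [boxAvg, boxAvg, smul_eq_mul, smul_eq_mul]
  gcongr
  exact h _

theorem norm_boxAvg_le_of_le (n : ℕ) {a : (Fin d → ℤ) → E} {c : ℝ} (h : ∀ x, ‖a x‖ ≤ c) :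
    ‖boxAvg n a‖ ≤ c :=
  (norm_boxAvg_le n a).trans ((boxAvg_mono n h).trans (boxAvg_const n c).le)

theorem boxAvg_neg_arg (n : ℕ) (a : (Fin d → ℤ) → E) :
    boxAvg n (fun x => a (-x)) = boxAvg n a := by
  rw [boxAvg, boxAvg]
  congr 1
  exact Finset.sum_nbij' (fun x => -x) (fun x => -x) (fun x hx => neg_mem_box.2 hx)
    (fun x hx => neg_mem_box.2 hx) (by simp) (by simp) (by simp)

/-- Both `B_n` and `y + B_n` lie in `B_{n+k}`, so each of their sums misses only `|B_{n+k}| - |B_n|`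
terms of the sum over the larger box. -/
theorem norm_boxAvg_shift_sub_le {k : ℕ} (n : ℕ) {y : Fin d → ℤ} (hy : y ∈ box d k)
    {a : (Fin d → ℤ) → E} {c : ℝ} (h : ∀ x, ‖a x‖ ≤ c) :
    ‖boxAvg n (fun x => a (y + x)) - boxAvg n a‖ ≤ boxDefect d k n * c := by
  classical
  have hN := card_box_pos d n
  have h1 : ∀ S ⊆ box d (n + k), S.card = (box d n).card →
      ‖∑ x ∈ box d (n + k), a x - ∑ x ∈ S, a x‖ ≤ ((box d (n + k)).card - (box d n).card) * c := by
    intro S hS hc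
    rw [← Finset.sum_sdiff hS, add_sub_cancel_right]
    refine (norm_sum_le_of_le _ fun x _ => h x).trans ?_
    rw [Finset.sum_const, nsmul_eq_mul, Finset.card_sdiff_of_subset hS, hc,
      Nat.cast_sub (Finset.card_le_card (box_mono (Nat.le_add_right _ _)))]
  have h2 : ∑ x ∈ box d n, a (y + x) = ∑ x ∈ (box d n).map (addLeftEmbedding y), a x := by
    simp
  have h3 := h1 _ (box_mono (Nat.le_add_right n k)) rfl
  have h4 := h1 ((box d n).map (addLeftEmbedding y)) (by
    intro z hz
    obtain ⟨w, hw, rfl⟩ := Finset.mem_map.1 hz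
    exact add_mem_box hy hw) (Finset.card_map _)
  rw [boxAvg, boxAvg, ← smul_sub, norm_smul, norm_inv, Real.norm_natCast, h2]
  have h5 : ‖∑ x ∈ (box d n).map (addLeftEmbedding y), a x - ∑ x ∈ box d n, a x‖
      ≤ 2 * (((box d (n + k)).card - (box d n).card) * c) := by
    rw [show ∑ x ∈ (box d n).map (addLeftEmbedding y), a x - ∑ x ∈ box d n, a x =
      (∑ x ∈ box d (n + k), a x - ∑ x ∈ box d n, a x) - (∑ x ∈ box d (n + k), a x -
        ∑ x ∈ (box d n).map (addLeftEmbedding y), a x) by abel]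
    exact (norm_sub_le _ _).trans (by linarith)
  refine (mul_le_mul_of_nonneg_left h5 (by positivity)).trans (le_of_eq ?_)
  rw [boxDefect]
  field_simp

theorem tendsto_boxAvg_shift_sub (y : Fin d → ℤ) {a : (Fin d → ℤ) → E} {c : ℝ}
    (h : ∀ x, ‖a x‖ ≤ c) :
    Tendsto (fun n => boxAvg n (fun x => a (y + x)) - boxAvg n a) atTop (𝓝 0) := by
  obtain ⟨k, hk⟩ := exists_mem_box y
  have := (tendsto_boxDefect d k).mul_const c
  rw [zero_mul] at this
  exact squeeze_zero_norm (fun n => norm_boxAvg_shift_sub_le n hk h) this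

end Box

/-! ### Mean ergodic theorem in Hilbert space -/

section Hilbert

variable {d : ℕ} {H : Type*} [NormedAddCommGroup H] [InnerProductSpace ℝ H] [CompleteSpace H]

/-- The mean ergodic theorem for box averages of an isometric representation of `ℤ^d`. -/
theorem exists_tendsto_boxAvg (U : (Fin d → ℤ) → H →ₗᵢ[ℝ] H)
    (hU : ∀ x y f, U (x + y) f = U x (U y f)) (f : H) :
    ∃ h : H, (∀ x, U x h = h) ∧ Tendsto (fun n => boxAvg n fun x => U x f) atTop (𝓝 h) := by
  have hcontr : ∀ n g, ‖boxAvg n fun x => U x g‖ ≤ ‖g‖ := fun n g =>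
    norm_boxAvg_le_of_le n fun x => ((U x).norm_map g).le
  -- The vectors whose averages vanish in the limit form a subspace, closed because averaging is a
  -- contraction. It contains all differences `U y g - g`, so its orthogonal complement consists of
  -- invariant vectors.
  let S : Submodule ℝ H :=
    { carrier := {g | Tendsto (fun n => boxAvg n fun x => U x g) atTop (𝓝 0)}
      zero_mem' := by simp [boxAvg_const]
      add_mem' := by
        intro a b ha hb
        simpa [boxAvg_add] using ha.add hb
      smul_mem' := by
        intro c a ha
        simpa [boxAvg_smul] using ha.const_smul c }
  have hclosed : IsClosed (S : Set H) := by
    refine isClosed_of_closure_subset fun g hg => ?_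
    refine Metric.tendsto_atTop.2 fun ε hε => ?_
    obtain ⟨g', hg', hd⟩ := Metric.mem_closure_iff.1 hg (ε / 2) (half_pos hε)
    obtain ⟨N, hN⟩ := Metric.tendsto_atTop.1 hg' (ε / 2) (half_pos hε)
    refine ⟨N, fun n hn => ?_⟩
    have h1 := hN n hn
    have h2 := hcontr n (g - g')
    simp only [map_sub, boxAvg_sub] at h2
    rw [dist_zero_right] at h1 ⊢
    rw [dist_eq_norm] at hd
    have h3 := norm_add_le ((boxAvg n fun x => U x g) - boxAvg n fun x => U x g')
      (boxAvg n fun x => U x g')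
    rw [sub_add_cancel] at h3
    linarith
  have hcob : ∀ y g, U y g - g ∈ S := by
    intro y g
    have := tendsto_boxAvg_shift_sub y (a := fun x => U x g) (c := ‖g‖)
      fun x => ((U x).norm_map g).le
    refine this.congr fun n => ?_
    rw [← boxAvg_sub]
    congr 1
    funext x
    rw [map_sub, ← hU, add_comm]
  have : CompleteSpace S := hclosed.completeSpace_coe
  obtain ⟨s, hs, h, hh, rfl⟩ := S.exists_add_mem_mem_orthogonal f
  -- Orthogonality to `U x h - h` gives `⟪h, U x h⟫ = ‖h‖²`, which for an isometry forces `‖U x h -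
  -- h‖ = 0`.
  have hinv : ∀ x, U x h = h := by
    intro x
    have h1 := (S.mem_orthogonal' h).1 hh _ (hcob x h)
    rw [inner_sub_right, real_inner_self_eq_norm_sq] at h1
    have h2 := norm_sub_sq_real (U x h) h
    rw [(U x).norm_map, real_inner_comm] at h2
    have h3 : ‖U x h - h‖ ^ 2 = 0 := by linarith
    rwa [sq_eq_zero_iff, norm_eq_zero, sub_eq_zero] at h3
  refine ⟨h, hinv, ?_⟩
  have hs' : Tendsto (fun n => boxAvg n fun x => U x s) atTop (𝓝 0) := hs
  simpa [boxAvg_add, hinv, boxAvg_const] using hs'.add_const h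

end Hilbert

/-! ### Vitali covering and the maximal inequality -/

section Maximal

variable {d : ℕ}

theorem sub_mem_box_iff {n : ℕ} {x y : Fin d → ℤ} :
    y - x ∈ box d n ↔ y ∈ Metric.closedBall x (n : ℝ) := by
  rw [mem_box, Metric.mem_closedBall, dist_pi_le_iff (Nat.cast_nonneg n)]
  refine forall_congr' fun i => ?_
  rw [Int.dist_eq, Pi.sub_apply]
  exact_mod_cast Iff.rfl

theorem card_box_mul_le (k n : ℕ) (hk : 1 ≤ k) :
    (box d (k * n)).card ≤ k ^ d * (box d n).card := by
  rw [card_box, card_box, ← mul_pow]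
  gcongr
  nlinarith

/-- A covering estimate: if every point of `S` is the center of a box on which the average of `a`
exceeds `c`, then `S` cannot be large. -/
theorem mul_card_le_sum_box (c : ℝ≥0∞) (a : (Fin d → ℤ) → ℝ≥0∞) (N : ℕ)
    (S : Finset (Fin d → ℤ)) (hS : S ⊆ box d N) (r : (Fin d → ℤ) → ℕ) (hr : ∀ x ∈ S, r x ≤ N)
    (h : ∀ x ∈ S, c * (box d (r x)).card ≤ ∑ y ∈ box d (r x), a (y + x)) :
    c * S.card ≤ 5 ^ d * ∑ y ∈ box d (2 * N), a y := by
  classical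
  -- Translated boxes are closed balls of the sup metric. The selected balls are disjoint and their
  -- fivefold enlargements cover `S`, whence the factor `5 ^ d`. Centers in `B_N` and radii at most
  -- `N` keep them inside `B_{2N}`.
  obtain ⟨u, hu, hdisj, hcov⟩ := Vitali.exists_disjoint_subfamily_covering_enlargement_closedBall
    (S : Set (Fin d → ℤ)) (fun x => x) (fun x => (r x : ℝ)) N
    (fun x hx => by exact_mod_cast hr x hx) 5 (by norm_num)
  let T : Finset (Fin d → ℤ) := S.filter (· ∈ u)
  have hTu : ∀ b, b ∈ T ↔ b ∈ u := fun b => by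
    simp only [T, Finset.mem_filter, and_iff_right_iff_imp]
    exact fun hb => hu hb
  have hTS : T ⊆ S := Finset.filter_subset _ _
  have hcard : S.card ≤ ∑ b ∈ T, 5 ^ d * (box d (r b)).card := by
    have hsub : S ⊆ T.biUnion fun b => (box d (5 * r b)).image (· + b) := by
      intro x hx
      obtain ⟨b, hb, hxb⟩ := hcov x hx
      refine Finset.mem_biUnion.2 ⟨b, (hTu b).2 hb, Finset.mem_image.2 ⟨x - b, ?_, by simp⟩⟩
      rw [sub_mem_box_iff]
      push_cast
      exact hxb (Metric.mem_closedBall_self (Nat.cast_nonneg _))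
    refine (Finset.card_le_card hsub).trans (Finset.card_biUnion_le.trans ?_)
    refine Finset.sum_le_sum fun b _ => Finset.card_image_le.trans ?_
    exact card_box_mul_le 5 _ (by norm_num)
  have hsum : ∑ b ∈ T, ∑ y ∈ box d (r b), a (y + b) ≤ ∑ y ∈ box d (2 * N), a y := by
    have h1 : ∀ b ∈ T, ∑ y ∈ box d (r b), a (y + b) =
        ∑ y ∈ (box d (r b)).map (addRightEmbedding b), a y := fun b _ => by simp
    rw [Finset.sum_congr rfl h1, ← Finset.sum_biUnion]
    · refine Finset.sum_le_sum_of_subset fun y hy => ?_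
      obtain ⟨b, hb, hyb⟩ := Finset.mem_biUnion.1 hy
      obtain ⟨z, hz, rfl⟩ := Finset.mem_map.1 hyb
      rw [two_mul]
      exact add_mem_box (box_mono (hr b (hTS hb)) hz) (hS (hTS hb))
    · intro b hb b' hb' hne
      refine Finset.disjoint_left.2 fun y hy hy' => ?_
      have hmem : ∀ b, y ∈ (box d (r b)).map (addRightEmbedding b) →
          y ∈ Metric.closedBall b (r b : ℝ) := by
        intro b hy
        obtain ⟨z, hz, rfl⟩ := Finset.mem_map.1 hy
        rw [← sub_mem_box_iff]
        simpa using hz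
      exact Set.disjoint_left.1 (hdisj ((hTu b).1 hb) ((hTu b').1 hb') hne) (hmem b hy) (hmem b' hy')
  calc c * S.card ≤ c * (∑ b ∈ T, 5 ^ d * (box d (r b)).card : ℕ) := by gcongr
    _ = 5 ^ d * ∑ b ∈ T, c * (box d (r b)).card := by
      push_cast
      rw [Finset.mul_sum, Finset.mul_sum]
      exact Finset.sum_congr rfl fun b _ => by ring
    _ ≤ 5 ^ d * ∑ b ∈ T, ∑ y ∈ box d (r b), a (y + b) := by
      gcongr with b hb
      exact h b (hTS hb)
    _ ≤ _ := by gcongr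

variable {Ω : Type*} [MeasurableSpace Ω] [AddAction (Fin d → ℤ) Ω] {μ : Measure Ω}
  [VAddInvariantMeasure (Fin d → ℤ) Ω μ] [MeasurableConstVAdd (Fin d → ℤ) Ω]

theorem measurableSet_boxSum {f : Ω → ℝ≥0∞} (hf : Measurable f) (c : ℝ≥0∞) (n : ℕ) :
    MeasurableSet {ω | c * (box d n).card ≤ ∑ x ∈ box d n, f (x +ᵥ ω)} :=
  measurableSet_le measurable_const
    (Finset.measurable_sum _ fun x _ => hf.comp (measurable_const_vadd x))

/-- Transference: the covering estimate holds along the orbit of every `ω`, and integrating it turns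
both sides into multiples of `μ E` and `∫ f` by invariance. The constant is `5 ^ d` from covering
times `2 ^ d` from `|B_{2N}| ≤ 2 ^ d |B_N|`. -/
theorem maximal_inequality_of_le {f : Ω → ℝ≥0∞} (hf : Measurable f) (c : ℝ≥0∞) (N : ℕ) :
    c * μ {ω | ∃ n ≤ N, c * (box d n).card ≤ ∑ x ∈ box d n, f (x +ᵥ ω)} ≤
      10 ^ d * ∫⁻ ω, f ω ∂μ := by
  classical
  set E := {ω | ∃ n ≤ N, c * (box d n).card ≤ ∑ x ∈ box d n, f (x +ᵥ ω)} with hE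
  have hEm : MeasurableSet E := by
    have : E = ⋃ n ≤ N, {ω | c * (box d n).card ≤ ∑ x ∈ box d n, f (x +ᵥ ω)} := by
      ext ω
      simp [hE]
    rw [this]
    exact MeasurableSet.biUnion (Set.to_countable _) fun n _ => measurableSet_boxSum hf c n
  have hpt : ∀ ω, ∑ x ∈ box d N, E.indicator (fun _ => c) (x +ᵥ ω) ≤
      5 ^ d * ∑ x ∈ box d (2 * N), f (x +ᵥ ω) := by
    intro ω
    have hex : ∀ x : Fin d → ℤ, ∃ n, x +ᵥ ω ∈ E →
        n ≤ N ∧ c * (box d n).card ≤ ∑ y ∈ box d n, f (y +ᵥ x +ᵥ ω) := by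
      intro x
      by_cases hx : x +ᵥ ω ∈ E
      · obtain ⟨n, hn⟩ := hx
        exact ⟨n, fun _ => hn⟩
      · exact ⟨0, fun h => absurd h hx⟩
    choose r hr using hex
    have := mul_card_le_sum_box c (fun x => f (x +ᵥ ω)) N
      ((box d N).filter fun x => x +ᵥ ω ∈ E) (Finset.filter_subset _ _) r
      (fun x hx => (hr x (Finset.mem_filter.1 hx).2).1)
      (fun x hx => by simpa only [add_vadd] using (hr x (Finset.mem_filter.1 hx).2).2)
    refine le_trans (le_of_eq ?_) this
    simp only [Set.indicator_apply]
    rw [← Finset.sum_filter, Finset.sum_const, nsmul_eq_mul, mul_comm]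
  have hint := lintegral_mono (μ := μ) hpt
  have hmp : ∀ x : Fin d → ℤ, MeasurePreserving (x +ᵥ · : Ω → Ω) μ μ := fun x =>
    measurePreserving_vadd x μ
  have hfm : ∀ x : Fin d → ℤ, Measurable fun ω : Ω => f (x +ᵥ ω) := fun x =>
    hf.comp (measurable_const_vadd x)
  have him : ∀ x : Fin d → ℤ, Measurable fun ω : Ω => E.indicator (fun _ => c) (x +ᵥ ω) :=
    fun x => (measurable_const.indicator hEm).comp (measurable_const_vadd x)
  rw [lintegral_const_mul _ (Finset.measurable_sum _ fun x _ => hfm x),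
    lintegral_finsetSum _ fun x _ => hfm x, lintegral_finsetSum _ fun x _ => him x] at hint
  simp only [fun x => (hmp x).lintegral_comp hf,
    fun x => (hmp x).lintegral_comp (measurable_const.indicator hEm : Measurable
      (E.indicator fun _ => c)), lintegral_indicator_const hEm, Finset.sum_const,
    nsmul_eq_mul] at hint
  have hpos : ((box d N).card : ℝ≥0∞) ≠ 0 := by
    have := card_box_pos d N
    exact_mod_cast this.ne'
  refine (ENNReal.mul_le_mul_iff_right hpos (ENNReal.natCast_ne_top _)).1 (hint.trans ?_)
  have h2 : ((box d (2 * N)).card : ℝ≥0∞) ≤ 2 ^ d * (box d N).card := by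
    exact_mod_cast card_box_mul_le 2 N (by norm_num)
  calc 5 ^ d * (((box d (2 * N)).card : ℝ≥0∞) * ∫⁻ ω, f ω ∂μ)
      ≤ 5 ^ d * (2 ^ d * (box d N).card * ∫⁻ ω, f ω ∂μ) := by gcongr
    _ = (5 * 2) ^ d * ((box d N).card * ∫⁻ ω, f ω ∂μ) := by rw [mul_pow]; ring
    _ = _ := by norm_num; ring

/-- The maximal inequality for box averages. -/
theorem maximal_inequality {f : Ω → ℝ≥0∞} (hf : Measurable f) (c : ℝ≥0∞) :
    c * μ {ω | ∃ n, c * (box d n).card ≤ ∑ x ∈ box d n, f (x +ᵥ ω)} ≤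
      10 ^ d * ∫⁻ ω, f ω ∂μ := by
  have hU : {ω | ∃ n, c * (box d n).card ≤ ∑ x ∈ box d n, f (x +ᵥ ω)} =
      ⋃ N : ℕ, {ω | ∃ n ≤ N, c * (box d n).card ≤ ∑ x ∈ box d n, f (x +ᵥ ω)} := by
    ext ω
    simp only [Set.mem_ofPred_eq, Set.mem_iUnion]
    exact ⟨fun ⟨n, hn⟩ => ⟨n, n, le_rfl, hn⟩, fun ⟨_, n, _, hn⟩ => ⟨n, hn⟩⟩
  have hmono : Monotone fun N : ℕ =>
      {ω | ∃ n ≤ N, c * (box d n).card ≤ ∑ x ∈ box d n, f (x +ᵥ ω)} :=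
    fun N M hNM ω ⟨n, hn, h⟩ => ⟨n, hn.trans hNM, h⟩
  rw [hU, hmono.measure_iUnion, ENNReal.mul_iSup]
  exact iSup_le fun N => maximal_inequality_of_le hf c N

end Maximal

/-! ### Mean ergodic theorem for measure-preserving actions -/

section MeanErgodic

variable {d : ℕ} {Ω : Type*} [MeasurableSpace Ω] [AddAction (Fin d → ℤ) Ω] {μ : Measure Ω}
  [VAddInvariantMeasure (Fin d → ℤ) Ω μ] [MeasurableConstVAdd (Fin d → ℤ) Ω]

/-- The mean ergodic theorem in `L²` for box averages of a measure-preserving action of `ℤ^d`. -/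
theorem exists_invariant_tendsto_eLpNorm {f : Ω → ℝ} (hf : MemLp f 2 μ) :
    ∃ h : Ω → ℝ, Measurable h ∧ MemLp h 2 μ ∧
      (∀ x : Fin d → ℤ, (fun ω => h (x +ᵥ ω)) =ᵐ[μ] h) ∧
      Tendsto (fun n => eLpNorm (fun ω => (boxAvg n fun x : Fin d → ℤ => f (x +ᵥ ω)) - h ω) 2 μ)
        atTop (𝓝 0) := by
  have hmp : ∀ x : Fin d → ℤ, MeasurePreserving (x +ᵥ · : Ω → Ω) μ μ := fun x =>
    measurePreserving_vadd x μ
  let U : (Fin d → ℤ) → Lp ℝ 2 μ →ₗᵢ[ℝ] Lp ℝ 2 μ := fun x =>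
    Lp.compMeasurePreservingₗᵢ ℝ (x +ᵥ ·) (hmp x)
  have hUae : ∀ x g, U x g =ᵐ[μ] fun ω => g (x +ᵥ ω) := fun x g =>
    Lp.coeFn_compMeasurePreserving g (hmp x)
  have hU : ∀ x y g, U (x + y) g = U x (U y g) := by
    intro x y g
    apply Lp.ext
    filter_upwards [hUae (x + y) g, hUae x (U y g), (hmp x).quasiMeasurePreserving.ae (hUae y g)]
      with ω h1 h2 h3
    -- Composition with translations reverses their order, which is harmless as the group is
    -- commutative.
    rw [h1, h2, h3, add_comm x y, add_vadd]
  obtain ⟨h, hinv, hlim⟩ := exists_tendsto_boxAvg U hU (hf.toLp f)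
  refine ⟨h, (Lp.stronglyMeasurable h).measurable, Lp.memLp h, fun x => ?_, ?_⟩
  · have := hUae x h
    rw [hinv] at this
    exact this.symm
  · rw [Lp.tendsto_Lp_iff_tendsto_eLpNorm'] at hlim
    refine hlim.congr fun n => eLpNorm_congr_ae ?_
    have hsum : ∀ s : Finset (Fin d → ℤ), ⇑(∑ x ∈ s, U x (hf.toLp f)) =ᵐ[μ]
        fun ω => ∑ x ∈ s, f (x +ᵥ ω) := by
      intro s
      have h1 : ∀ᵐ ω ∂μ, ∀ x : Fin d → ℤ, U x (hf.toLp f) ω = f (x +ᵥ ω) := by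
        rw [ae_all_iff]
        intro x
        filter_upwards [hUae x (hf.toLp f),
          (hmp x).quasiMeasurePreserving.ae hf.coeFn_toLp] with ω h1 h2
        rw [h1, h2]
      filter_upwards [h1, Lp.coeFn_finsetSum s fun x => U x (hf.toLp f)] with ω h1 h2
      rw [h2, Finset.sum_apply]
      exact Finset.sum_congr rfl fun x _ => h1 x
    filter_upwards [Lp.coeFn_smul ((box d n).card : ℝ)⁻¹ (∑ x ∈ box d n, U x (hf.toLp f)),
      hsum (box d n)] with ω h1 h2
    simp only [Pi.sub_apply, boxAvg]
    rw [h1, Pi.smul_apply, h2]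

end MeanErgodic

/-! ### Pointwise ergodic theorem along boxes -/

section Pointwise

variable {d : ℕ}

theorem boxAvg_comm (m n : ℕ) (a : (Fin d → ℤ) → (Fin d → ℤ) → ℝ) :
    boxAvg m (fun x => boxAvg n fun y => a x y) = boxAvg n fun y => boxAvg m fun x => a x y := by
  simp only [boxAvg, smul_eq_mul, Finset.mul_sum]
  rw [Finset.sum_comm]
  exact Finset.sum_congr rfl fun x _ => Finset.sum_congr rfl fun y _ => by ring

/-- After exchanging the averages this is a fixed finite average of shift errors, each tending to
zero. -/
theorem tendsto_boxAvg_boxAvg_sub (N : ℕ) {a : (Fin d → ℤ) → ℝ} {C : ℝ} (h : ∀ x, ‖a x‖ ≤ C) :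
    Tendsto (fun n => (boxAvg n fun x => boxAvg N fun y => a (y + x)) - boxAvg n a) atTop
      (𝓝 0) := by
  have h1 : ∀ n, (boxAvg n fun x => boxAvg N fun y => a (y + x)) - boxAvg n a =
      boxAvg N fun y => (boxAvg n fun x => a (y + x)) - boxAvg n a := by
    intro n
    rw [boxAvg_sub, boxAvg_const, boxAvg_comm]
  simp only [h1]
  have h2 := (tendsto_finsetSum (box d N) fun y _ =>
    tendsto_boxAvg_shift_sub y h).const_smul ((box d N).card : ℝ)⁻¹
  simpa only [boxAvg, Finset.sum_const_zero, smul_zero] using h2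

theorem boxAvg_lt_of_sum_enorm_lt {n : ℕ} {a : (Fin d → ℤ) → ℝ} {ε : ℝ} (hε : 0 < ε)
    (h : ∑ x ∈ box d n, ‖a x‖ₑ < ENNReal.ofReal ε * (box d n).card) : ‖boxAvg n a‖ < ε := by
  refine (norm_boxAvg_le n a).trans_lt ?_
  have hN := card_box_pos d n
  rw [boxAvg, smul_eq_mul, inv_mul_lt_iff₀ hN, mul_comm]
  have h1 : ∑ x ∈ box d n, ‖a x‖ₑ = ENNReal.ofReal (∑ x ∈ box d n, ‖a x‖) := by
    rw [ENNReal.ofReal_sum_of_nonneg fun _ _ => norm_nonneg _]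
    simp only [ofReal_norm]
  rw [h1, ← ENNReal.ofReal_natCast, ← ENNReal.ofReal_mul hε.le,
    ENNReal.ofReal_lt_ofReal_iff (by positivity)] at h
  exact h

variable {Ω : Type*} [MeasurableSpace Ω] [AddAction (Fin d → ℤ) Ω] {μ : Measure Ω}
  [VAddInvariantMeasure (Fin d → ℤ) Ω μ] [MeasurableConstVAdd (Fin d → ℤ) Ω]

theorem measurable_boxAvg {f : Ω → ℝ} (hf : Measurable f) (n : ℕ) :
    Measurable fun ω => boxAvg n fun x : Fin d → ℤ => f (x +ᵥ ω) := by
  have hfm : ∀ x : Fin d → ℤ, Measurable fun ω : Ω => f (x +ᵥ ω) := fun x =>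
    hf.comp (measurable_const_vadd x)
  exact (Finset.measurable_sum _ fun x _ => hfm x).const_smul ((box d n).card : ℝ)⁻¹

/-- The pointwise ergodic theorem along boxes, for a bounded function and a measure-preserving
action of `ℤ^d`. -/
theorem exists_invariant_ae_tendsto_boxAvg [IsProbabilityMeasure μ] {f : Ω → ℝ}
    (hf : Measurable f) {C : ℝ} (hC : ∀ ω, ‖f ω‖ ≤ C) :
    ∃ h : Ω → ℝ, Measurable h ∧ (∀ x : Fin d → ℤ, (fun ω => h (x +ᵥ ω)) =ᵐ[μ] h) ∧
      ∀ᵐ ω ∂μ, Tendsto (fun n => boxAvg n fun x : Fin d → ℤ => f (x +ᵥ ω)) atTop (𝓝 (h ω)) := by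
  have hf2 : MemLp f 2 μ := MemLp.of_bound hf.aestronglyMeasurable C (ae_of_all _ hC)
  obtain ⟨h, hm, -, hinv, hlim⟩ := exists_invariant_tendsto_eLpNorm (d := d) hf2
  let F : ℕ → Ω → ℝ := fun N ω => (boxAvg N fun x : Fin d → ℤ => f (x +ᵥ ω)) - h ω
  have hF : ∀ N, Measurable (F N) := fun N => (measurable_boxAvg hf N).sub hm
  have hlim1 : Tendsto (fun N => ∫⁻ ω, ‖F N ω‖ₑ ∂μ) atTop (𝓝 0) := by
    refine tendsto_of_tendsto_of_tendsto_of_le_of_le tendsto_const_nhds hlim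
      (fun _ => zero_le) fun N => ?_
    rw [← eLpNorm_one_eq_lintegral_enorm]
    exact eLpNorm_le_eLpNorm_of_exponent_le (by norm_num) (hF N).aestronglyMeasurable
  have hinv' : ∀ᵐ ω ∂μ, ∀ x : Fin d → ℤ, h (x +ᵥ ω) = h ω := ae_all_iff.2 hinv
  have key : ∀ ε : ℝ, 0 < ε → ∀ᵐ ω ∂μ, ∀ᶠ n in atTop, ‖F n ω‖ < 2 * ε := by
    intro ε hε
    let M : ℕ → Set Ω := fun N => {ω | ∃ n, ENNReal.ofReal ε * (box d n).card ≤
      ∑ x ∈ box d n, ‖F N (x +ᵥ ω)‖ₑ}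
    -- Up to a null set, `F n` is the average over `B_n` of `F N`, below `ε` off `M N`, plus the
    -- error of smoothing `f` over `B_N` first, eventually below `ε`.
    have hgood : ∀ N, ∀ᵐ ω ∂μ, ω ∉ M N → ∀ᶠ n in atTop, ‖F n ω‖ < 2 * ε := by
      intro N
      filter_upwards [hinv'] with ω hω hM
      have h1 := tendsto_boxAvg_boxAvg_sub N (a := fun x : Fin d → ℤ => f (x +ᵥ ω)) fun x => hC _
      filter_upwards [Metric.tendsto_nhds.1 h1 ε hε] with n hn
      have hlt : ‖boxAvg n fun x : Fin d → ℤ => F N (x +ᵥ ω)‖ < ε :=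
        boxAvg_lt_of_sum_enorm_lt hε (not_le.1 fun hle => hM ⟨n, hle⟩)
      simp only [F, hω, boxAvg_sub, boxAvg_const] at hlt ⊢
      simp only [add_vadd] at hn
      rw [dist_zero_right, norm_sub_rev] at hn
      have := norm_add_le
        ((boxAvg n fun x : Fin d → ℤ => f (x +ᵥ ω)) -
          boxAvg n fun x : Fin d → ℤ => boxAvg N fun y : Fin d → ℤ => f (y +ᵥ x +ᵥ ω))
        ((boxAvg n fun x : Fin d → ℤ => boxAvg N fun y : Fin d → ℤ => f (y +ᵥ x +ᵥ ω)) - h ω)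
      rw [sub_add_sub_cancel] at this
      linarith
    have hε' : ENNReal.ofReal ε ≠ 0 := (ENNReal.ofReal_pos.2 hε).ne'
    -- The bad set on the left does not depend on `N`, while the right side tends to zero by the
    -- mean ergodic theorem.
    have hbound : ∀ N, ENNReal.ofReal ε * μ {ω | ¬ ∀ᶠ n in atTop, ‖F n ω‖ < 2 * ε} ≤
        10 ^ d * ∫⁻ ω, ‖F N ω‖ₑ ∂μ := by
      intro N
      refine le_trans ?_ (maximal_inequality (hF N).enorm (ENNReal.ofReal ε))
      gcongr 1
      refine measure_mono_ae ?_
      filter_upwards [hgood N] with ω hω hbad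
      by_contra hM
      exact hbad (hω hM)
    have hz : Tendsto (fun N => 10 ^ d * ∫⁻ ω, ‖F N ω‖ₑ ∂μ) atTop (𝓝 (10 ^ d * 0)) :=
      ENNReal.Tendsto.const_mul hlim1 (Or.inr (by finiteness))
    rw [mul_zero] at hz
    have := le_antisymm (ge_of_tendsto' hz hbound) zero_le
    exact (mul_eq_zero.1 this).resolve_left hε'
  have hall : ∀ᵐ ω ∂μ, ∀ k : ℕ, ∀ᶠ n in atTop, ‖F n ω‖ < 2 * (1 / ((k : ℝ) + 1)) :=
    ae_all_iff.2 fun k => key _ (by positivity)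
  refine ⟨h, hm, hinv, ?_⟩
  filter_upwards [hall] with ω hω
  refine Metric.tendsto_nhds.2 fun ε hε => ?_
  obtain ⟨k, hk⟩ := exists_nat_one_div_lt (half_pos hε)
  filter_upwards [hω k] with n hn
  rw [dist_eq_norm]
  exact hn.trans (by linarith)

end Pointwise

/-! ### Measurability of translations -/

section Translations

variable {G : Type*} [AddCommGroup G]

theorem vadd_setoid_rel (x : G) (π : Setoid G) (y z : G) : (x +ᵥ π) y z ↔ π (y - x) (z - x) :=
  Iff.rfl

theorem vadd_coloring_apply (x : G) (X : G → Fin 2) (y : G) : (x +ᵥ X) y = X (y - x) := rfl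

/-- A finite set has finitely many partitions, each determined by finitely many relations, so the
events `u ~ v` generate the σ-algebra. -/
theorem measurable_setoid {Ω V : Type*} [MeasurableSpace Ω] {φ : Ω → Setoid V}
    (h : ∀ u v, MeasurableSet {ω | φ ω u v}) : Measurable φ := by
  rw [measurable_iff_comap_le, instMeasurableSpaceSetoid, MeasurableSpace.comap_iSup]
  refine iSup_le fun K => ?_
  rw [MeasurableSpace.comap_comp]
  rintro _ ⟨s, -, rfl⟩
  have hfin : Finite (Setoid K) := Finite.of_injective (fun ρ : Setoid K => fun u v => ρ u v)
    fun ρ ρ' h => Setoid.ext fun u v => iff_of_eq (congrFun (congrFun h u) v)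
  have hs : (induced K ∘ φ) ⁻¹' s = ⋃ ρ ∈ s, ⋂ u : K, ⋂ v : K, {ω | φ ω u v ↔ ρ u v} := by
    ext ω
    simp only [Set.mem_preimage, Function.comp_apply, Set.mem_iUnion, Set.mem_iInter,
      Set.mem_ofPred_eq, exists_prop]
    constructor
    · exact fun hω => ⟨_, hω, fun u v => Iff.rfl⟩
    · rintro ⟨ρ, hρ, h⟩
      have : induced K (φ ω) = ρ := Setoid.ext fun u v => h u v
      rwa [this]
  rw [hs]
  refine MeasurableSet.biUnion s.to_countable fun ρ _ => MeasurableSet.iInter fun u =>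
    MeasurableSet.iInter fun v => ?_
  exact (h u v).iff (MeasurableSet.const _)

instance instMeasurableConstVAddSetoid : MeasurableConstVAdd G (Setoid G) :=
  ⟨fun x => measurable_setoid fun u v => measurableSet_rel (u - x) (v - x)⟩

instance instMeasurableConstVAddColoring : MeasurableConstVAdd G (G → Fin 2) :=
  ⟨fun x => measurable_pi_lambda _ fun y => measurable_pi_apply (y - x)⟩

instance instMeasurableConstVAddProd {M α β : Type*} [VAdd M α] [VAdd M β] [MeasurableSpace α]
    [MeasurableSpace β] [MeasurableConstVAdd M α] [MeasurableConstVAdd M β] :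
    MeasurableConstVAdd M (α × β) :=
  ⟨fun x => ((measurable_const_vadd x).comp measurable_fst).prodMk
    ((measurable_const_vadd x).comp measurable_snd)⟩

end Translations

/-! ### Colors given the partition -/

section ColorLaw

variable {V : Type*} (p : unitInterval) (π : Setoid V)

theorem measurable_pullback_quotient {W : Type*} (a : W → Quotient π) :
    Measurable fun (ω : Quotient π → Fin 2) w => ω (a w) :=
  measurable_pi_lambda _ fun w => measurable_pi_apply (a w)

/-- Colors of two families of vertices are independent given the partition, if no cluster
meets both families. -/
theorem indepFun_colorLawGiven {ι κ : Type*} [Finite ι] [Finite κ] (a : ι → V) (b : κ → V)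
    (h : ∀ i j, ¬ π (a i) (b j)) :
    IndepFun (fun (X : V → Fin 2) i => X (a i)) (fun (X : V → Fin 2) j => X (b j))
      (colorLawGiven p π) := by
  classical
  have := Fintype.ofFinite ι
  have := Fintype.ofFinite κ
  let S : Finset (Quotient π) := Finset.univ.image fun i => Quotient.mk π (a i)
  let T : Finset (Quotient π) := Finset.univ.image fun j => Quotient.mk π (b j)
  have hST : Disjoint S T := by
    rw [Finset.disjoint_left]
    intro q hq hq'
    obtain ⟨i, -, rfl⟩ := Finset.mem_image.1 hq
    obtain ⟨j, -, hj⟩ := Finset.mem_image.1 hq'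
    exact h i j (π.symm (Quotient.exact hj))
  have hind := (iIndepFun_infinitePi (P := fun _ : Quotient π => bernoulliMeasure (1 : Fin 2) 0 p)
    (X := fun _ c => c) fun _ => measurable_id).indepFun_finset S T hST
      fun q => measurable_pi_apply q
  have hS : ∀ i, Quotient.mk π (a i) ∈ S := fun i =>
    Finset.mem_image_of_mem _ (Finset.mem_univ i)
  have hT : ∀ j, Quotient.mk π (b j) ∈ T := fun j =>
    Finset.mem_image_of_mem _ (Finset.mem_univ j)
  have hind' := hind.comp (φ := fun (c : S → Fin 2) i => c ⟨_, hS i⟩)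
    (ψ := fun (c : T → Fin 2) j => c ⟨_, hT j⟩)
    (measurable_pi_lambda _ fun i => measurable_pi_apply _)
    (measurable_pi_lambda _ fun j => measurable_pi_apply _)
  have hm : Measurable fun (ω : Quotient π → Fin 2) v => ω (Quotient.mk π v) :=
    measurable_pullback_quotient π _
  have hma : Measurable fun (X : V → Fin 2) i => X (a i) :=
    measurable_pi_lambda _ fun i => measurable_pi_apply _
  have hmb : Measurable fun (X : V → Fin 2) j => X (b j) :=
    measurable_pi_lambda _ fun i => measurable_pi_apply _
  rw [indepFun_iff_measure_inter_preimage_eq_mul] at hind' ⊢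
  intro s t hs ht
  rw [colorLawGiven, Measure.map_apply hm ((hma hs).inter (hmb ht)),
    Measure.map_apply hm (hma hs), Measure.map_apply hm (hmb ht)]
  exact hind' s t hs ht

theorem measurableSet_color_eq_one (v : V) : MeasurableSet {X : V → Fin 2 | X v = 1} :=
  measurable_pi_apply v (measurableSet_singleton 1)

theorem colorLawGiven_real_eq_one (v : V) :
    (colorLawGiven p π).real {X | X v = 1} = p := by
  have hm : Measurable fun (ω : Quotient π → Fin 2) v => ω (Quotient.mk π v) :=
    measurable_pullback_quotient π _
  have h := Measure.infinitePi_map_eval (fun _ : Quotient π => bernoulliMeasure (1 : Fin 2) 0 p)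
    (Quotient.mk π v)
  rw [measureReal_def, colorLawGiven, Measure.map_apply hm (measurableSet_color_eq_one v)]
  have h1 : (fun (ω : Quotient π → Fin 2) v => ω (Quotient.mk π v)) ⁻¹' {X | X v = 1} =
      (fun ω : Quotient π → Fin 2 => ω (Quotient.mk π v)) ⁻¹' {1} := rfl
  rw [h1, ← Measure.map_apply (measurable_pi_apply _) (measurableSet_singleton _), h,
    ← measureReal_def]
  classical
  rw [bernoulliMeasure_real_apply p (measurableSet_singleton 1)]
  simp

open Classical in
-- The covariance of two colors detects whether the vertices share a cluster; this is how cluster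
-- frequencies are read off from colorings.
theorem colorLawGiven_real_inter (u v : V) :
    (colorLawGiven p π).real {X | X u = 1 ∧ X v = 1} =
      (p : ℝ) ^ 2 + if π u v then (p : ℝ) - p ^ 2 else 0 := by
  split_ifs with h
  · have hm : Measurable fun (ω : Quotient π → Fin 2) v => ω (Quotient.mk π v) :=
      measurable_pullback_quotient π _
    have hset : (fun (ω : Quotient π → Fin 2) v => ω (Quotient.mk π v)) ⁻¹'
        {X | X u = 1 ∧ X v = 1} =
        (fun (ω : Quotient π → Fin 2) v => ω (Quotient.mk π v)) ⁻¹' {X | X v = 1} := by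
      ext ω
      have : Quotient.mk π u = Quotient.mk π v := Quotient.sound h
      simp [this]
    have h1 := colorLawGiven_real_eq_one p π v
    rw [measureReal_def, colorLawGiven, Measure.map_apply hm (measurableSet_color_eq_one v)] at h1
    have hinter : MeasurableSet {X : V → Fin 2 | X u = 1 ∧ X v = 1} :=
      (measurableSet_color_eq_one u).inter (measurableSet_color_eq_one v)
    rw [measureReal_def, colorLawGiven, Measure.map_apply hm hinter, hset, h1]
    ring
  · have hind := (indepFun_colorLawGiven p π (fun _ : Unit => u) (fun _ : Unit => v)
      fun _ _ => h)
    rw [indepFun_iff_measure_inter_preimage_eq_mul] at hind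
    have h1 := hind {c | c () = 1} {c | c () = 1}
      (measurable_pi_apply () (measurableSet_singleton 1))
      (measurable_pi_apply () (measurableSet_singleton 1))
    have h2 := congrArg ENNReal.toReal h1
    rw [ENNReal.toReal_mul] at h2
    have hu := colorLawGiven_real_eq_one p π u
    have hv := colorLawGiven_real_eq_one p π v
    rw [measureReal_def] at hu hv ⊢
    refine h2.trans ?_
    change (colorLawGiven p π {X | X u = 1}).toReal * (colorLawGiven p π {X | X v = 1}).toReal = _
    rw [hu, hv]
    ring

/-- The map `y ↦ y - x` sends distinct clusters of `x +ᵥ π` to distinct clusters of `π`, and an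
i.i.d. family pulled back along an injection is i.i.d. with the same marginals. -/
theorem colorLawGiven_vadd {G : Type*} [AddCommGroup G] (p : unitInterval) (x : G)
    (π : Setoid G) : colorLawGiven p (x +ᵥ π) = (colorLawGiven p π).map (x +ᵥ ·) := by
  let f : Quotient (x +ᵥ π) → Quotient π :=
    Quotient.lift (fun y => Quotient.mk π (y - x)) fun a b h => Quotient.sound h
  have hf : Function.Injective f := by
    intro a b
    induction a using Quotient.inductionOn
    induction b using Quotient.inductionOn
    exact fun h => Quotient.sound (Quotient.exact h :)
  have hm : Measurable fun (ω : Quotient π → Fin 2) v => ω (Quotient.mk π v) :=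
    measurable_pullback_quotient π _
  have hm' : Measurable fun (ω : Quotient (x +ᵥ π) → Fin 2) v => ω (Quotient.mk _ v) :=
    measurable_pullback_quotient _ _
  rw [colorLawGiven, colorLawGiven, Measure.map_map (measurable_const_vadd x) hm,
    ← Measure.map_infinitePi_infinitePi_of_inj
      (P := fun _ : Quotient π => bernoulliMeasure (1 : Fin 2) 0 p) hf,
    Measure.map_map hm' (by fun_prop)]
  rfl

end ColorLaw

/-! ### The joint law and its stationarity -/

section JointLaw

instance instIsProbabilityMeasureJointLaw {V : Type*} [Countable V] (ν : Measure (Setoid V))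
    [IsProbabilityMeasure ν] (p : unitInterval) : IsProbabilityMeasure (jointLaw ν p) := by
  rw [jointLaw]
  infer_instance

theorem jointLaw_apply {V : Type*} [Countable V] (ν : Measure (Setoid V)) [SFinite ν]
    (p : unitInterval) {s : Set (Setoid V × (V → Fin 2))} (hs : MeasurableSet s) :
    jointLaw ν p s = ∫⁻ π, colorLawGiven p π (Prod.mk π ⁻¹' s) ∂ν :=
  Measure.compProd_apply hs

theorem fst_jointLaw {V : Type*} [Countable V] (ν : Measure (Setoid V)) [SFinite ν]
    (p : unitInterval) : (jointLaw ν p).fst = ν := by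
  rw [jointLaw, Measure.fst_compProd]

theorem measurable_colorLawGiven_section {G : Type*} [Countable G] (p : unitInterval)
    {s : Set (Setoid G × (G → Fin 2))}
    (hs : MeasurableSet s) : Measurable fun π => colorLawGiven p π (Prod.mk π ⁻¹' s) :=
  Kernel.measurable_kernel_prodMk_left (κ := colorKernel G p) hs

theorem colorLawGiven_section_vadd {G : Type*} [AddCommGroup G] (p : unitInterval) (x : G)
    (π : Setoid G) {s : Set (Setoid G × (G → Fin 2))} (hs : MeasurableSet s) :
    colorLawGiven p (x +ᵥ π) (Prod.mk (x +ᵥ π) ⁻¹' s) =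
      colorLawGiven p π (Prod.mk π ⁻¹' ((x +ᵥ ·) ⁻¹' s)) := by
  rw [colorLawGiven_vadd, Measure.map_apply (measurable_const_vadd x) (measurable_prodMk_left hs)]
  rfl

variable {G : Type*} [AddCommGroup G] [Countable G] (ν : Measure (Setoid G))
  [IsProbabilityMeasure ν] [VAddInvariantMeasure G (Setoid G) ν] (p : unitInterval)

instance instVAddInvariantMeasureJointLaw :
    VAddInvariantMeasure G (Setoid G × (G → Fin 2)) (jointLaw ν p) := by
  refine ⟨fun x s hs => ?_⟩
  rw [jointLaw_apply _ _ hs, jointLaw_apply _ _ (measurable_const_vadd x hs),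
    ← (measurePreserving_vadd x ν).lintegral_comp (measurable_colorLawGiven_section p hs)]
  exact lintegral_congr fun π => (colorLawGiven_section_vadd p x π hs).symm

end JointLaw

/-! ### Factors and invariant functions of ergodic actions -/

section Ergodic

variable {G α β : Type*} [VAdd G α] [VAdd G β] [MeasurableSpace α]
  [MeasurableSpace β] {μ : Measure α}

/-- A factor of an ergodic action is ergodic. -/
theorem ergodicVAdd_map [MeasurableConstVAdd G β] (hμ : ErgodicVAdd G α μ) {φ : α → β}
    (hφ : Measurable φ) (heq : ∀ (g : G) a, φ (g +ᵥ a) = g +ᵥ φ a) :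
    ErgodicVAdd G β (μ.map φ) where
  measure_preimage_vadd g s hs := by
    rw [Measure.map_apply hφ hs, Measure.map_apply hφ (measurable_const_vadd g hs),
      ← hμ.measure_preimage_vadd g (hφ hs)]
    congr 1
    ext a
    simp [heq]
  aeconst_of_forall_preimage_vadd_ae_eq {s} hs hinv := by
    have h1 := hμ.aeconst_of_forall_preimage_vadd_ae_eq (hφ hs) fun g => by
      have h2 := ae_of_ae_map hφ.aemeasurable (hinv g)
      filter_upwards [h2] with a ha
      have ha' : (g +ᵥ φ a ∈ s) = (φ a ∈ s) := ha
      rw [← heq] at ha'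
      exact ha'
    rw [eventuallyConst_set] at h1 ⊢
    exact h1.imp (ae_map_iff hφ.aemeasurable hs).2 (ae_map_iff hφ.aemeasurable hs.compl).2

/-- Preimages of measurable sets are null or conull, and countably many measurable sets separate the
points of `ℝ`. -/
theorem ae_eq_const_of_invariant [ErgodicVAdd G α μ] {h : α → ℝ} (hm : Measurable h)
    (hinv : ∀ g : G, (fun a => h (g +ᵥ a)) =ᵐ[μ] h) : ∃ c, h =ᵐ[μ] fun _ => c := by
  refine exists_eventuallyEq_const_of_forall_separating MeasurableSet fun U hU => ?_
  have h1 := ErgodicVAdd.aeconst_of_forall_preimage_vadd_ae_eq (G := G) (μ := μ) (hm hU) fun g => by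
    filter_upwards [hinv g] with a ha
    exact congrArg (· ∈ U) ha
  rw [eventuallyConst_set] at h1
  exact h1

end Ergodic

/-! ### Ergodic averages and correlations -/

section BoxErgodic

theorem boxAvg_integral {d : ℕ} {Ω : Type*} [MeasurableSpace Ω] {μ : Measure Ω}
    {f : (Fin d → ℤ) → Ω → ℝ} (hf : ∀ x, Integrable (f x) μ) (n : ℕ) :
    ∫ ω, boxAvg n (fun x => f x ω) ∂μ = boxAvg n fun x => ∫ ω, f x ω ∂μ := by
  simp only [boxAvg]
  rw [integral_smul, integral_finsetSum _ fun x _ => hf x]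

variable {d : ℕ} {Ω : Type*} [MeasurableSpace Ω] [AddAction (Fin d → ℤ) Ω] {μ : Measure Ω}
  [MeasurableConstVAdd (Fin d → ℤ) Ω] [IsProbabilityMeasure μ]

/-- The limit in the pointwise theorem is invariant, hence constant. All averages have the same
integral as `f`, which identifies the constant by dominated convergence. -/
theorem ae_tendsto_boxAvg_integral [ErgodicVAdd (Fin d → ℤ) Ω μ] {f : Ω → ℝ} (hf : Measurable f)
    {C : ℝ} (hC : ∀ ω, ‖f ω‖ ≤ C) :
    ∀ᵐ ω ∂μ, Tendsto (fun n => boxAvg n fun x : Fin d → ℤ => f (x +ᵥ ω)) atTop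
      (𝓝 (∫ ω, f ω ∂μ)) := by
  obtain ⟨h, hm, hinv, hlim⟩ := exists_invariant_ae_tendsto_boxAvg (d := d) (μ := μ) hf hC
  obtain ⟨c, hc⟩ := ae_eq_const_of_invariant hm hinv
  have hlim' : ∀ᵐ ω ∂μ, Tendsto (fun n => boxAvg n fun x : Fin d → ℤ => f (x +ᵥ ω)) atTop
      (𝓝 c) := by
    filter_upwards [hlim, hc] with ω h1 h2
    rwa [← h2]
  have h1 := tendsto_integral_of_dominated_convergence (fun _ => C)
    (fun n => (measurable_boxAvg hf n).aestronglyMeasurable) (integrable_const C)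
    (fun n => ae_of_all _ fun ω => norm_boxAvg_le_of_le n fun x => hC _) hlim'
  have hmp : ∀ x : Fin d → ℤ, MeasurePreserving (x +ᵥ · : Ω → Ω) μ μ := fun x =>
    measurePreserving_vadd x μ
  have hfi : Integrable f μ := Integrable.of_bound hf.aestronglyMeasurable C (ae_of_all _ hC)
  have h2 : ∀ n, ∫ ω, (boxAvg n fun x : Fin d → ℤ => f (x +ᵥ ω)) ∂μ = ∫ ω, f ω ∂μ := by
    intro n
    have hint : ∀ x : Fin d → ℤ, Integrable (fun ω => f (x +ᵥ ω)) μ := fun x =>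
      (hmp x).integrable_comp_of_integrable hfi
    rw [boxAvg_integral hint]
    have h3 : ∀ x : Fin d → ℤ, ∫ ω, f (x +ᵥ ω) ∂μ = ∫ ω, f ω ∂μ := fun x => by
      have h4 := integral_map (μ := μ) (φ := fun ω : Ω => x +ᵥ ω)
        (measurable_const_vadd x).aemeasurable (f := f) hf.aestronglyMeasurable
      rw [← h4, (hmp x).map_eq]
    simp only [h3, boxAvg_const]
  simp only [h2, integral_const, probReal_univ, one_smul] at h1
  rw [tendsto_nhds_unique h1 tendsto_const_nhds] at hlim'
  exact hlim'

/-- Ergodicity makes correlations vanish on average. -/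
theorem tendsto_boxAvg_correlation [ErgodicVAdd (Fin d → ℤ) Ω μ] {f : Ω → ℝ} (hf : Measurable f)
    {C : ℝ} (hC : ∀ ω, ‖f ω‖ ≤ C) :
    Tendsto (fun n => boxAvg n fun x : Fin d → ℤ => ∫ ω, f ω * f (x +ᵥ ω) ∂μ) atTop
      (𝓝 ((∫ ω, f ω ∂μ) ^ 2)) := by
  have hlim := ae_tendsto_boxAvg_integral (d := d) (μ := μ) hf hC
  have hfm : ∀ x : Fin d → ℤ, Measurable fun ω : Ω => f (x +ᵥ ω) := fun x =>
    hf.comp (measurable_const_vadd x)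
  have h1 := tendsto_integral_of_dominated_convergence (μ := μ)
    (F := fun n ω => f ω * boxAvg n fun x : Fin d → ℤ => f (x +ᵥ ω))
    (f := fun ω => f ω * ∫ ω, f ω ∂μ) (fun _ => C * C)
    (fun n => (hf.mul (measurable_boxAvg hf n)).aestronglyMeasurable) (integrable_const _)
    (fun n => ae_of_all _ fun ω => by
      rw [norm_mul]
      exact mul_le_mul (hC ω) (norm_boxAvg_le_of_le n fun x => hC _) (norm_nonneg _)
        ((norm_nonneg _).trans (hC ω)))
    (by filter_upwards [hlim] with ω h using h.const_mul _)
  rw [integral_mul_const, ← sq] at h1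
  refine h1.congr fun n => ?_
  rw [← boxAvg_integral]
  · congr 1
    funext ω
    simp only [← smul_eq_mul (f ω), boxAvg_smul]
  · intro x
    refine Integrable.of_bound (hf.mul (hfm x)).aestronglyMeasurable (C * C)
      (ae_of_all _ fun ω => ?_)
    rw [norm_mul]
    exact mul_le_mul (hC ω) (hC _) (norm_nonneg _) ((norm_nonneg _).trans (hC ω))

end BoxErgodic

/-! ### Densities of clusters -/

section Density

variable {d : ℕ}

open Classical in
theorem ncard_inter_box_div (S : Set (Fin d → ℤ)) (n : ℕ) :
    ((S ∩ (box d n : Set (Fin d → ℤ))).ncard : ℝ) / ((box d n).card : ℝ) =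
      boxAvg n fun x => if x ∈ S then (1 : ℝ) else 0 := by
  have h : S ∩ (box d n : Set (Fin d → ℤ)) = ((box d n).filter (· ∈ S) : Finset _) := by
    ext x
    simp [and_comm]
  rw [h, Set.ncard_coe_finset, boxAvg, smul_eq_mul, ← Finset.sum_filter, Finset.sum_const,
    nsmul_eq_mul, mul_one, div_eq_inv_mul]

open Classical in
/-- If the averages of almost every coloring of the clusters converge, every cluster has a
density. -/
theorem exists_hasDensity_of_ae_tendsto {p : unitInterval} (hp₀ : 0 < p) (hp₁ : p < 1)
    {π : Setoid (Fin d → ℤ)}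
    (h : ∀ᵐ X ∂colorLawGiven p π, ∃ l, Tendsto (fun n => boxAvg n fun x : Fin d → ℤ =>
      if X x = 1 then (1 : ℝ) else 0) atTop (𝓝 l)) (u : Fin d → ℤ) :
    ∃ α, HasDensity {x | π x u} α := by
  have := isProbabilityMeasure_colorLawGiven p π
  let F : (Fin d → ℤ) → ((Fin d → ℤ) → Fin 2) → ℝ := fun x X => if X x = 1 then 1 else 0
  have hF : ∀ x, Measurable (F x) := fun x =>
    Measurable.ite (measurableSet_color_eq_one x) measurable_const measurable_const
  have hF1 : ∀ x X, ‖F x X‖ ≤ 1 := by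
    intro x X
    simp only [F]
    split_ifs <;> simp
  have havg : ∀ n, Measurable fun X => boxAvg n fun x => F x X := fun n =>
    (Finset.measurable_sum _ fun x _ => hF x).const_smul ((box d n).card : ℝ)⁻¹
  -- The factor `F u X` singles out the cluster of `u`: the product has expectation `p² + (p - p²)`
  -- times the frequency of that cluster in `B_n`. Since `p - p² ≠ 0`, convergence of the
  -- expectations yields the density.
  have hlim : ∀ᵐ X ∂colorLawGiven p π, Tendsto (fun n => F u X * boxAvg n fun x => F x X) atTop
      (𝓝 (F u X * limUnder atTop fun n => boxAvg n fun x => F x X)) := by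
    filter_upwards [h] with X hX
    exact (tendsto_nhds_limUnder hX).const_mul _
  have h1 := tendsto_integral_of_dominated_convergence (fun _ => 1)
    (fun n => ((hF u).mul (havg n)).aestronglyMeasurable) (integrable_const _)
    (fun n => ae_of_all _ fun X => by
      rw [Pi.mul_apply, norm_mul]
      exact mul_le_one₀ (hF1 u X) (norm_nonneg _) (norm_boxAvg_le_of_le n fun x => hF1 x X)) hlim
  have hprod : ∀ x, ∫ X, F u X * F x X ∂colorLawGiven p π =
      (p : ℝ) ^ 2 + ((p : ℝ) - p ^ 2) * if x ∈ {x | π x u} then 1 else 0 := by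
    intro x
    have h2 : (fun X => F u X * F x X) =
        {X : (Fin d → ℤ) → Fin 2 | X u = 1 ∧ X x = 1}.indicator 1 := by
      funext X
      by_cases h3 : X u = 1 <;> by_cases h4 : X x = 1 <;> simp [F, h3, h4]
    have hinter : MeasurableSet {X : (Fin d → ℤ) → Fin 2 | X u = 1 ∧ X x = 1} :=
      (measurableSet_color_eq_one u).inter (measurableSet_color_eq_one x)
    rw [h2, integral_indicator_one hinter, colorLawGiven_real_inter]
    by_cases h3 : π u x
    · simp [h3, π.symm h3]
    · have h4 : ¬ π x u := fun h4 => h3 (π.symm h4)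
      simp [h3, h4]
  have hint : ∀ n, ∫ X, (F u X * boxAvg n fun x => F x X) ∂colorLawGiven p π =
      (p : ℝ) ^ 2 + ((p : ℝ) - p ^ 2) *
        boxAvg n fun x => if x ∈ {x | π x u} then (1 : ℝ) else 0 := by
    intro n
    simp only [← smul_eq_mul (F u _), ← boxAvg_smul]
    rw [boxAvg_integral]
    · simp only [smul_eq_mul, hprod]
      rw [boxAvg_add, boxAvg_const]
      congr 1
      simp only [← smul_eq_mul ((p : ℝ) - p ^ 2), boxAvg_smul]
    · intro x
      refine Integrable.of_bound ((hF u).mul (hF x)).aestronglyMeasurable 1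
        (ae_of_all _ fun X => ?_)
      rw [norm_smul]
      exact mul_le_one₀ (hF1 u X) (norm_nonneg _) (hF1 x X)
  simp only [Pi.mul_apply, hint] at h1
  have hp : (p : ℝ) - p ^ 2 ≠ 0 := by
    have h2 : (0 : ℝ) < p := hp₀
    have h3 : (p : ℝ) < 1 := hp₁
    nlinarith
  have h2 := (h1.sub_const ((p : ℝ) ^ 2)).const_mul ((p : ℝ) - p ^ 2)⁻¹
  refine ⟨_, h2.congr fun n => ?_⟩
  rw [ncard_inter_box_div, add_sub_cancel_left, inv_mul_cancel_left₀ hp]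

/-- Almost surely, all clusters of a stationary random equivalence relation have a density. -/
theorem ae_exists_hasDensity (ν : Measure (Setoid (Fin d → ℤ))) [IsProbabilityMeasure ν]
    [VAddInvariantMeasure (Fin d → ℤ) (Setoid (Fin d → ℤ)) ν] :
    ∀ᵐ π ∂ν, ∀ u, ∃ α, HasDensity {x | π x u} α := by
  classical
  -- An auxiliary coloring, unrelated to the given one; the claim concerns `ν` alone, so any
  -- parameter strictly between 0 and 1 would do.
  let p : unitInterval := ⟨1 / 2, by norm_num, by norm_num⟩
  have hp₀ : 0 < p := by
    rw [← Subtype.coe_lt_coe]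
    norm_num [p]
  have hp₁ : p < 1 := by
    rw [← Subtype.coe_lt_coe]
    norm_num [p]
  let f : Setoid (Fin d → ℤ) × ((Fin d → ℤ) → Fin 2) → ℝ := fun z => if z.2 0 = 1 then 1 else 0
  have hf : Measurable f := Measurable.ite
    (measurable_snd (measurableSet_color_eq_one 0)) measurable_const measurable_const
  have hf1 : ∀ z, ‖f z‖ ≤ 1 := by
    intro z
    simp only [f]
    split_ifs <;> simp
  obtain ⟨h, -, -, hlim⟩ :=
    exists_invariant_ae_tendsto_boxAvg (d := d) (μ := jointLaw ν p) hf hf1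
  filter_upwards [Measure.ae_ae_of_ae_compProd hlim] with π hπ u
  refine exists_hasDensity_of_ae_tendsto hp₀ hp₁ ?_ u
  have hπ' : ∀ᵐ X ∂colorLawGiven p π, Tendsto (fun n => boxAvg n fun x : Fin d → ℤ =>
      f (x +ᵥ (π, X))) atTop (𝓝 (h (π, X))) := hπ
  filter_upwards [hπ'] with X hX
  refine ⟨_, hX.congr fun n => ?_⟩
  -- Translating by `x` and reading the color at `0` gives the color at `-x`, and boxes are
  -- symmetric.
  rw [← boxAvg_neg_arg]
  congr 1
  funext x
  simp only [f, Prod.vadd_mk, vadd_coloring_apply]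
  simp

/-- If there are no clusters of positive density, then on average over `x` two vertices `u` and
`x` are unlikely to be in the same cluster. -/
theorem tendsto_boxAvg_rel (ν : Measure (Setoid (Fin d → ℤ))) [IsProbabilityMeasure ν]
    [VAddInvariantMeasure (Fin d → ℤ) (Setoid (Fin d → ℤ)) ν]
    (hν : ν {π | ∃ φ ∈ π.classes, HasPositiveDensity φ} = 0) (u : Fin d → ℤ) :
    Tendsto (fun n => boxAvg n fun x => ν.real {π : Setoid (Fin d → ℤ) | π x u}) atTop (𝓝 0) := by
  classical
  let F : (Fin d → ℤ) → Setoid (Fin d → ℤ) → ℝ := fun x => {π | π x u}.indicator 1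
  have hF : ∀ x, Measurable (F x) := fun x => measurable_one.indicator (measurableSet_rel x u)
  have hF0 : ∀ x π, 0 ≤ F x π := fun x π => Set.indicator_nonneg (fun _ _ => zero_le_one) π
  have hF1 : ∀ x π, ‖F x π‖ ≤ 1 := fun x π => by
    rw [Real.norm_of_nonneg (hF0 x π)]
    exact Set.indicator_le_self' (fun _ _ => zero_le_one) π
  have havg : ∀ n, Measurable fun π => boxAvg n fun x => F x π := fun n =>
    (Finset.measurable_sum _ fun x _ => hF x).const_smul ((box d n).card : ℝ)⁻¹
  have hlim : ∀ᵐ π ∂ν, Tendsto (fun n => boxAvg n fun x => F x π) atTop (𝓝 0) := by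
    -- The density exists, is nonnegative and cannot be positive, so it is zero.
    filter_upwards [ae_exists_hasDensity ν, measure_eq_zero_iff_ae_notMem.1 hν] with π h1 h2
    obtain ⟨α, hα⟩ := h1 u
    have h3 : Tendsto (fun n => boxAvg n fun x => F x π) atTop (𝓝 α) := by
      refine hα.congr fun n => ?_
      rw [ncard_inter_box_div]
      rfl
    have h4 : 0 ≤ α := ge_of_tendsto' h3 fun n =>
      (boxAvg_const (d := d) n (0 : ℝ)).symm.le.trans (boxAvg_mono n fun x => hF0 x π)
    have h5 : ¬ 0 < α := fun h5 => h2 ⟨_, ⟨u, rfl⟩, α, h5, hα⟩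
    rwa [le_antisymm (not_lt.1 h5) h4] at h3
  have h1 := tendsto_integral_of_dominated_convergence (fun _ => 1)
    (fun n => (havg n).aestronglyMeasurable) (integrable_const _)
    (fun n => ae_of_all _ fun π => norm_boxAvg_le_of_le n fun x => hF1 x π) hlim
  rw [integral_zero] at h1
  refine h1.congr fun n => ?_
  rw [boxAvg_integral fun x => Integrable.of_bound (hF x).aestronglyMeasurable 1
    (ae_of_all _ (hF1 x))]
  congr 1
  funext x
  exact integral_indicator_one (measurableSet_rel x u)

end Density

/-! ### Approximation by cylinder events -/

section Cylinders

variable {V : Type*}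

/-- Events that depend on the partition and on the colors of finitely many vertices. -/
def cylinderEvents (V : Type*) : Set (Set (Setoid V × (V → Fin 2))) :=
  {A | ∃ (K : Finset V) (B : Set (Setoid V × (K → Fin 2))), MeasurableSet B ∧
    A = (fun z => (z.1, K.restrict z.2)) ⁻¹' B}

theorem measurable_prod_restrict (K : Finset V) :
    Measurable fun z : Setoid V × (V → Fin 2) => (z.1, K.restrict z.2) :=
  measurable_fst.prodMk ((Finset.measurable_restrict K).comp measurable_snd)

theorem isSetAlgebra_cylinderEvents : IsSetAlgebra (cylinderEvents V) where
  empty_mem := ⟨∅, ∅, MeasurableSet.empty, rfl⟩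
  compl_mem := by
    rintro _ ⟨K, B, hB, rfl⟩
    exact ⟨K, Bᶜ, hB.compl, rfl⟩
  union_mem := by
    classical
    rintro _ _ ⟨K, B, hB, rfl⟩ ⟨L, C, hC, rfl⟩
    refine ⟨K ∪ L,
      (fun z => (z.1, Finset.restrict₂ (π := fun _ => Fin 2) Finset.subset_union_left z.2)) ⁻¹' B ∪
      (fun z => (z.1, Finset.restrict₂ (π := fun _ => Fin 2) Finset.subset_union_right z.2)) ⁻¹' C,
      MeasurableSet.union ?_ ?_, rfl⟩
    · have h : Measurable fun z : Setoid V × ((K ∪ L : Finset V) → Fin 2) => (z.1,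
          Finset.restrict₂ (π := fun _ => Fin 2) (Finset.subset_union_left (s₁ := K) (s₂ := L)) z.2) :=
        measurable_fst.prodMk ((Finset.measurable_restrict₂ _).comp measurable_snd)
      exact h hB
    · have h : Measurable fun z : Setoid V × ((K ∪ L : Finset V) → Fin 2) => (z.1,
          Finset.restrict₂ (π := fun _ => Fin 2) (Finset.subset_union_right (s₁ := K) (s₂ := L)) z.2) :=
        measurable_fst.prodMk ((Finset.measurable_restrict₂ _).comp measurable_snd)
      exact h hC

theorem generateFrom_cylinderEvents : (inferInstance : MeasurableSpace (Setoid V × (V → Fin 2))) =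
    MeasurableSpace.generateFrom (cylinderEvents V) := by
  refine le_antisymm (sup_le ?_ ?_) (MeasurableSpace.generateFrom_le ?_)
  · rintro _ ⟨s, hs, rfl⟩
    exact MeasurableSpace.measurableSet_generateFrom ⟨∅, Prod.fst ⁻¹' s, measurable_fst hs, rfl⟩
  · rw [MeasurableSpace.pi, MeasurableSpace.comap_iSup]
    refine iSup_le fun v => ?_
    rw [MeasurableSpace.comap_comp]
    rintro _ ⟨s, hs, rfl⟩
    have h : Measurable fun z : Setoid V × (({v} : Finset V) → Fin 2) =>
        z.2 ⟨v, Finset.mem_singleton_self v⟩ := (measurable_pi_apply _).comp measurable_snd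
    exact MeasurableSpace.measurableSet_generateFrom ⟨{v}, _, h hs, rfl⟩
  · rintro _ ⟨K, B, hB, rfl⟩
    exact measurable_prod_restrict K hB

theorem measureDense_cylinderEvents (μ : Measure (Setoid V × (V → Fin 2))) [IsFiniteMeasure μ] :
    μ.MeasureDense (cylinderEvents V) :=
  Measure.MeasureDense.of_generateFrom_isSetAlgebra_finite μ isSetAlgebra_cylinderEvents
    generateFrom_cylinderEvents

end Cylinders

/-! ### Approximate independence of translated cylinder events -/

section Mixing

theorem jointLaw_real_apply {V : Type*} [Countable V] (ν : Measure (Setoid V)) [IsFiniteMeasure ν]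
    (p : unitInterval) {s : Set (Setoid V × (V → Fin 2))} (hs : MeasurableSet s) :
    (jointLaw ν p).real s = ∫ π, (colorLawGiven p π).real (Prod.mk π ⁻¹' s) ∂ν := by
  rw [measureReal_def, jointLaw_apply ν p hs]
  refine (integral_toReal (measurable_colorLawGiven_section p hs).aemeasurable
    (ae_of_all _ fun π => ?_)).symm
  have := isProbabilityMeasure_colorLawGiven p π
  exact measure_lt_top _ _

/-- The event `A` reads colors on `K` and its preimage under translation by `x` reads them on `K -
x`; by assumption no cluster meets both sets. -/
theorem colorLawGiven_real_inter_eq_mul {G : Type*} [AddCommGroup G] (p : unitInterval)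
    (π : Setoid G) (x : G) (K : Finset G) {B : Set (Setoid G × (K → Fin 2))}
    (hB : MeasurableSet B) (h : ∀ u ∈ K, ∀ v ∈ K, ¬ π (v - x) u) {A : Set (Setoid G × (G → Fin 2))}
    (hA : A = (fun z => (z.1, K.restrict z.2)) ⁻¹' B) :
    (colorLawGiven p π).real (Prod.mk π ⁻¹' (A ∩ (x +ᵥ ·) ⁻¹' A)) =
      (colorLawGiven p π).real (Prod.mk π ⁻¹' A) *
        (colorLawGiven p (x +ᵥ π)).real (Prod.mk (x +ᵥ π) ⁻¹' A) := by
  have hAm : MeasurableSet A := hA ▸ measurable_prod_restrict K hB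
  have hind := indepFun_colorLawGiven p π (fun u : K => (u : G)) (fun v : K => (v : G) - x)
    fun u v huv => h u u.2 v v.2 (π.symm huv)
  rw [indepFun_iff_measure_inter_preimage_eq_mul] at hind
  have h1 := congrArg ENNReal.toReal (hind (Prod.mk π ⁻¹' B) (Prod.mk (x +ᵥ π) ⁻¹' B)
    (measurable_prodMk_left hB) (measurable_prodMk_left hB))
  rw [ENNReal.toReal_mul] at h1
  rw [measureReal_def, measureReal_def, measureReal_def, colorLawGiven_section_vadd p x π hAm]
  subst hA
  exact h1

variable {G : Type*} [AddCommGroup G] [Countable G] (ν : Measure (Setoid G))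
  [IsProbabilityMeasure ν] [VAddInvariantMeasure G (Setoid G) ν] (p : unitInterval)

/-- The conditional probabilities agree unless a cluster meets both `K` and `K - x`, and always
differ by at most 1. The right side is the union bound over pairs of vertices. -/
theorem abs_jointLaw_real_inter_sub_le (x : G) (K : Finset G) {B : Set (Setoid G × (K → Fin 2))}
    (hB : MeasurableSet B) {A : Set (Setoid G × (G → Fin 2))}
    (hA : A = (fun z => (z.1, K.restrict z.2)) ⁻¹' B) :
    |(jointLaw ν p).real (A ∩ (x +ᵥ ·) ⁻¹' A) -
      ∫ π, (colorLawGiven p π).real (Prod.mk π ⁻¹' A) *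
        (colorLawGiven p (x +ᵥ π)).real (Prod.mk (x +ᵥ π) ⁻¹' A) ∂ν| ≤
      ∑ u ∈ K, ∑ v ∈ K, ν.real {π : Setoid G | π (-x) (u - v)} := by
  have hprob := isProbabilityMeasure_colorLawGiven (V := G) p
  have hAm : MeasurableSet A := hA ▸ measurable_prod_restrict K hB
  have hAx : MeasurableSet (A ∩ (x +ᵥ ·) ⁻¹' A) := hAm.inter (measurable_const_vadd x hAm)
  have hm : ∀ {s : Set (Setoid G × (G → Fin 2))}, MeasurableSet s →
      Measurable fun π => (colorLawGiven p π).real (Prod.mk π ⁻¹' s) :=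
    fun hs => (measurable_colorLawGiven_section p hs).ennreal_toReal
  have hmx : Measurable fun π =>
      (colorLawGiven p (x +ᵥ π)).real (Prod.mk (x +ᵥ π) ⁻¹' A) :=
    (hm hAm).comp (measurable_const_vadd x)
  have h0 : ∀ (π : Setoid G) s, 0 ≤ (colorLawGiven p π).real s := fun π s => measureReal_nonneg
  have h1 : ∀ (π : Setoid G) s, (colorLawGiven p π).real s ≤ 1 := fun π s => measureReal_le_one
  have hi1 : Integrable (fun π => (colorLawGiven p π).real
      (Prod.mk π ⁻¹' (A ∩ (x +ᵥ ·) ⁻¹' A))) ν :=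
    Integrable.of_bound (hm hAx).aestronglyMeasurable 1 (ae_of_all _ fun π => by
      rw [Real.norm_of_nonneg (h0 _ _)]
      exact h1 _ _)
  have hi2 : Integrable (fun π => (colorLawGiven p π).real (Prod.mk π ⁻¹' A) *
        (colorLawGiven p (x +ᵥ π)).real (Prod.mk (x +ᵥ π) ⁻¹' A)) ν :=
    Integrable.of_bound ((hm hAm).mul hmx).aestronglyMeasurable 1 (ae_of_all _ fun π => by
      rw [Real.norm_of_nonneg (mul_nonneg (h0 _ _) (h0 _ _))]
      exact mul_le_one₀ (h1 _ _) (h0 _ _) (h1 _ _))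
  have hi3 : ∀ u v : G, Integrable ({π : Setoid G | π (v - x) u}.indicator (1 : Setoid G → ℝ)) ν :=
    fun u v => (integrable_const (1 : ℝ)).indicator (measurableSet_rel _ _)
  -- Stationarity makes `u - v` the fixed vertex and `-x` the moving one, the form in which
  -- averaging over `x` applies.
  have hrel : ∀ u v : G, ∫ π, {π : Setoid G | π (v - x) u}.indicator (1 : Setoid G → ℝ) π ∂ν =
      ν.real {π : Setoid G | π (-x) (u - v)} := by
    intro u v
    rw [integral_indicator_one (measurableSet_rel _ _), measureReal_def, measureReal_def,
      ← measure_preimage_vadd_of_nullMeasurableSet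
        (measurableSet_rel (-x) (u - v)).nullMeasurableSet (-v)]
    congr 2
    ext π
    rw [Set.mem_preimage, Set.mem_ofPred_eq, Set.mem_ofPred_eq, vadd_setoid_rel]
    rw [sub_neg_eq_add, sub_neg_eq_add, sub_add_cancel, neg_add_eq_sub]
  rw [jointLaw_real_apply ν p hAx, ← integral_sub hi1 hi2]
  refine abs_integral_le_integral_abs.trans ?_
  have hsum : ∫ π, ∑ u ∈ K, ∑ v ∈ K,
      {π : Setoid G | π (v - x) u}.indicator (1 : Setoid G → ℝ) π ∂ν =
      ∑ u ∈ K, ∑ v ∈ K, ν.real {π : Setoid G | π (-x) (u - v)} := by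
    rw [integral_finsetSum _ fun u _ => integrable_finsetSum _ fun v _ => hi3 u v]
    refine Finset.sum_congr rfl fun u _ => ?_
    rw [integral_finsetSum _ fun v _ => hi3 u v]
    exact Finset.sum_congr rfl fun v _ => hrel u v
  rw [← hsum]
  refine integral_mono (hi1.sub hi2).abs
    (integrable_finsetSum _ fun u _ => integrable_finsetSum _ fun v _ => hi3 u v) fun π => ?_
  have hind : ∀ u v : G, 0 ≤ {π : Setoid G | π (v - x) u}.indicator (1 : Setoid G → ℝ) π :=
    fun u v => Set.indicator_nonneg (fun _ _ => zero_le_one) π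
  by_cases h : ∀ u ∈ K, ∀ v ∈ K, ¬ π (v - x) u
  · simp only
    rw [colorLawGiven_real_inter_eq_mul p π x K hB h hA, sub_self, abs_zero]
    exact Finset.sum_nonneg fun u _ => Finset.sum_nonneg fun v _ => hind u v
  · push Not at h
    obtain ⟨u, hu, v, hv, huv⟩ := h
    have h2 : (1 : ℝ) ≤ ∑ u ∈ K, ∑ v ∈ K,
        {π : Setoid G | π (v - x) u}.indicator (1 : Setoid G → ℝ) π := by
      refine le_trans ?_ (Finset.single_le_sum
        (fun u _ => Finset.sum_nonneg fun v _ => hind u v) hu)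
      refine le_trans ?_ (Finset.single_le_sum (fun v _ => hind u v) hv)
      rw [Set.indicator_of_mem (show π ∈ {π : Setoid G | π (v - x) u} from huv)]
      exact le_rfl
    refine le_trans ?_ h2
    refine abs_sub_le_of_nonneg_of_le (h0 _ _) (h1 _ _) (mul_nonneg (h0 _ _) (h0 _ _)) ?_
    exact mul_le_one₀ (h1 _ _) (h0 _ _) (h1 _ _)

end Mixing

/-! ### Ergodicity of the joint law -/

section Main

variable {d : ℕ} {ν : Measure (Setoid (Fin d → ℤ))} [IsProbabilityMeasure ν]

/-- Cylinder events are mixing on average under the joint law. -/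
theorem tendsto_boxAvg_jointLaw_inter [ErgodicVAdd (Fin d → ℤ) (Setoid (Fin d → ℤ)) ν]
    (p : unitInterval) (hν : ν {π | ∃ φ ∈ π.classes, HasPositiveDensity φ} = 0)
    {A : Set (Setoid (Fin d → ℤ) × ((Fin d → ℤ) → Fin 2))}
    (hA : A ∈ cylinderEvents (Fin d → ℤ)) :
    Tendsto (fun n => boxAvg n fun x : Fin d → ℤ => (jointLaw ν p).real (A ∩ (x +ᵥ ·) ⁻¹' A)) atTop
      (𝓝 ((jointLaw ν p).real A ^ 2)) := by
  obtain ⟨K, B, hB, hAB⟩ := hA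
  have hAm : MeasurableSet A := hAB ▸ measurable_prod_restrict K hB
  let g : Setoid (Fin d → ℤ) → ℝ := fun π => (colorLawGiven p π).real (Prod.mk π ⁻¹' A)
  have hg : Measurable g := (measurable_colorLawGiven_section p hAm).ennreal_toReal
  have hg1 : ∀ π, ‖g π‖ ≤ 1 := fun π => by
    have := isProbabilityMeasure_colorLawGiven p π
    rw [Real.norm_of_nonneg measureReal_nonneg]
    exact measureReal_le_one
  -- Ergodicity of `ν` enters only here, applied to the conditional probability of `A` given the
  -- partition.
  have h1 := tendsto_boxAvg_correlation (d := d) (μ := ν) hg hg1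
  rw [jointLaw_real_apply ν p hAm]
  have h2 : Tendsto (fun n => ∑ u ∈ K, ∑ v ∈ K, boxAvg n fun x : Fin d → ℤ =>
      ν.real {π : Setoid (Fin d → ℤ) | π (-x) (u - v)}) atTop (𝓝 0) := by
    have h3 := tendsto_finsetSum K fun u _ => tendsto_finsetSum K fun v _ =>
      tendsto_boxAvg_rel ν hν (u - v)
    simp only [Finset.sum_const_zero] at h3
    refine h3.congr fun n => Finset.sum_congr rfl fun u _ => Finset.sum_congr rfl fun v _ => ?_
    exact (boxAvg_neg_arg n fun x => ν.real {π : Setoid (Fin d → ℤ) | π x (u - v)}).symm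
  have h4 : Tendsto (fun n => (boxAvg n fun x : Fin d → ℤ =>
      (jointLaw ν p).real (A ∩ (x +ᵥ ·) ⁻¹' A)) -
      boxAvg n fun x : Fin d → ℤ => ∫ π, g π * g (x +ᵥ π) ∂ν) atTop (𝓝 0) := by
    refine squeeze_zero_norm (fun n => ?_) h2
    rw [← boxAvg_sub]
    refine (norm_boxAvg_le n _).trans ((boxAvg_mono n fun x =>
      abs_jointLaw_real_inter_sub_le ν p x K hB hAB).trans (le_of_eq ?_))
    simp only [boxAvg, ← Finset.smul_sum]
    rw [Finset.sum_comm]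
    congr 1
    exact Finset.sum_congr rfl fun u _ => Finset.sum_comm
  have h5 := h4.add h1
  simpa only [sub_add_cancel, zero_add] using h5

/-- An invariant `E` agrees almost surely with `E ∩ x⁻¹E` for every `x`, so one cylinder
approximation of `E` works uniformly in `x` and survives averaging. -/
theorem ergodicVAdd_jointLaw (hE : ErgodicVAdd (Fin d → ℤ) (Setoid (Fin d → ℤ)) ν)
    (p : unitInterval) (hν : ν {π | ∃ φ ∈ π.classes, HasPositiveDensity φ} = 0) :
    ErgodicVAdd (Fin d → ℤ) (Setoid (Fin d → ℤ) × ((Fin d → ℤ) → Fin 2)) (jointLaw ν p) where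
  aeconst_of_forall_preimage_vadd_ae_eq {E} hEm hinv := by
    set P := jointLaw ν p with hP
    have hmp : ∀ x : Fin d → ℤ, MeasurePreserving
        (x +ᵥ · : Setoid (Fin d → ℤ) × ((Fin d → ℤ) → Fin 2) → _) P P := fun x =>
      measurePreserving_vadd x P
    -- Replacing `E` by `A` costs `2 * ε` in the intersection, once for each factor, and `2 * ε` in
    -- the square.
    have key : ∀ ε : ℝ, 0 < ε → |P.real E - P.real E ^ 2| ≤ 4 * ε := by
      intro ε hε
      have hdense := measureDense_cylinderEvents P
      obtain ⟨A, hA, hAE⟩ := hdense.approx E hEm (measure_ne_top _ _) ε hε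
      have hAm := hdense.measurable A hA
      have hEA : P.real (E ∆ A) ≤ ε := ENNReal.toReal_le_of_le_ofReal hε.le hAE.le
      have hdiff : ∀ x : Fin d → ℤ,
          ‖P.real E - P.real (A ∩ (x +ᵥ ·) ⁻¹' A)‖ ≤ 2 * ε := by
        intro x
        have hx : P.real E = P.real (E ∩ (x +ᵥ ·) ⁻¹' E) := by
          refine measureReal_congr ?_
          have := (ae_eq_refl E).inter (hinv x)
          rw [Set.inter_self] at this
          exact this.symm
        have hxm := measurable_const_vadd (α := Setoid (Fin d → ℤ) × ((Fin d → ℤ) → Fin 2)) x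
        have hpre : P.real ((x +ᵥ ·) ⁻¹' (E ∆ A)) = P.real (E ∆ A) := by
          rw [measureReal_def, measureReal_def,
            (hmp x).measure_preimage (hEm.symmDiff hAm).nullMeasurableSet]
        rw [hx, Real.norm_eq_abs]
        refine (abs_measureReal_sub_le_measureReal_symmDiff
          (hEm.inter (hxm hEm)).nullMeasurableSet (hAm.inter (hxm hAm)).nullMeasurableSet).trans ?_
        have hsub : (E ∩ (x +ᵥ ·) ⁻¹' E) ∆ (A ∩ (x +ᵥ ·) ⁻¹' A) ⊆
            (E ∆ A) ∪ (x +ᵥ ·) ⁻¹' (E ∆ A) := by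
          intro z hz
          simp only [Set.mem_symmDiff, Set.mem_inter_iff, Set.mem_preimage, Set.mem_union] at hz ⊢
          tauto
        refine (measureReal_mono hsub).trans ((measureReal_union_le _ _).trans ?_)
        rw [hpre]
        linarith
      have hlim := (tendsto_boxAvg_jointLaw_inter p hν hA).const_sub (P.real E)
      have h1 : ‖P.real E - P.real A ^ 2‖ ≤ 2 * ε := by
        refine le_of_tendsto' hlim.norm fun n => ?_
        have h2 := norm_boxAvg_le_of_le n hdiff
        rwa [boxAvg_sub, boxAvg_const] at h2
      have h3 : |P.real E - P.real A| ≤ ε :=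
        (abs_measureReal_sub_le_measureReal_symmDiff hEm.nullMeasurableSet
          hAm.nullMeasurableSet).trans hEA
      have h4 : |P.real A ^ 2 - P.real E ^ 2| ≤ 2 * ε := by
        rw [sq_sub_sq, abs_mul, abs_sub_comm]
        have h5 : |P.real A + P.real E| ≤ 2 := by
          rw [abs_of_nonneg (add_nonneg measureReal_nonneg measureReal_nonneg)]
          linarith [measureReal_le_one (μ := P) (s := A), measureReal_le_one (μ := P) (s := E)]
        exact mul_le_mul h5 h3 (abs_nonneg _) zero_le_two
      rw [Real.norm_eq_abs] at h1
      have h6 := abs_sub_le (P.real E) (P.real A ^ 2) (P.real E ^ 2)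
      linarith
    have hzero : P.real E - P.real E ^ 2 = 0 := by
      rw [← abs_eq_zero]
      refine le_antisymm (le_of_forall_pos_le_add fun ε hε => ?_) (abs_nonneg _)
      have := key (ε / 4) (by positivity)
      linarith
    have hprod : P.real E * (1 - P.real E) = 0 := by linarith
    rw [eventuallyConst_set]
    rcases mul_eq_zero.1 hprod with h | h
    · right
      rw [measureReal_eq_zero_iff] at h
      exact measure_eq_zero_iff_ae_notMem.1 h
    · left
      have h1 : P.real Eᶜ = 0 := by
        rw [probReal_compl_eq_one_sub hEm]
        exact h
      rw [measureReal_eq_zero_iff] at h1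
      exact mem_ae_iff.2 h1

end Main

end ColorProcess

theorem theorem6p5 (d : ℕ) (hd : 1 ≤ d) (p : unitInterval) (hp₀ : 0 < p) (hp₁ : p < 1)
    (ν : Measure (Setoid (Fin d → ℤ))) [IsProbabilityMeasure ν]
    [VAddInvariantMeasure (Fin d → ℤ) (Setoid (Fin d → ℤ)) ν]
    (hν : ν {π | ∃ φ ∈ π.classes, HasPositiveDensity φ} = 0) :
    (ErgodicVAdd (Fin d → ℤ) (Setoid (Fin d → ℤ)) ν ↔
      ErgodicVAdd (Fin d → ℤ) (Setoid (Fin d → ℤ) × ((Fin d → ℤ) → Fin 2)) (jointLaw ν p)) ∧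
    (ErgodicVAdd (Fin d → ℤ) (Setoid (Fin d → ℤ)) ν →
      ErgodicVAdd (Fin d → ℤ) ((Fin d → ℤ) → Fin 2) (colorLaw ν p)) := by
  refine ⟨⟨fun h => ergodicVAdd_jointLaw h p hν, fun h => ?_⟩, fun h => ?_⟩
  · have h1 := ergodicVAdd_map h measurable_fst fun _ _ => rfl
    rwa [← Measure.fst, fst_jointLaw] at h1
  · exact ergodicVAdd_map (ergodicVAdd_jointLaw h p hν) measurable_snd fun _ _ => rfl
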